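/- **Proposition 3.4 (Second Growth Lemma).** Let $n\ge 1$. For a non-negative locally integrable weight $\omega:\mathbb R^n\to[0,\infty)$ with $\omega>0$ almost everywhere, put $\mu=\omega^{-n}$ and $(f)_B=\frac1{|B|}\int_B f\,dx$; $\omega\in A_{1+\frac1n}$ means $$[\omega]_{A_{1+\frac1n}}=\sup_{B}\,(\omega)_B\,(\omega^{-n})_B^{1/n}<\infty ,$$ the supremum being over all balls $B\subset\mathbb R^n$. For an open set $\Omega\subset\mathbb R^n$ let $$[[\omega]]_{\mathrm{BMO}(\Omega,\omega)}=\sup_{B\subset\Omega}\Big(\frac1{\omega(B)}\int_B|\omega-(\omega)_B|^{n+1}\omega^{-n}\,dx\Big)^{\frac1{n+1}},\qquad \omega(B)=\int_B\omega\,dx,$$ the supremum being over all balls $B\subset\Omega$. For $Y=(y,s)\in\mathbb R^n\times\mathbb R$, $r>0$ and $h\in(0,1]$ let $$C^h_{r,\mu}(Y)=B_r(y)\times\big(s-hr^2(\mu)_{B_r(y)}^{1/n},\,s\big),\qquad \mathcal Lu=u_t-\omega(x)\sum_{i,j=1}^n a_{ij}(x,t)D_{ij}u .$$ For all $\nu\in(0,1)$,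 $K_0\in[1,\infty)$, $h\in(0,1]$, and for $r\ge\rho>0$, there are constants $\epsilon_2,\beta_2\in(0,1)$ depending only on $n,\nu,K_0,r/\rho,h$ (in particular, on $r$ and $\rho$ only through $r/\rho$) such that the following holds. Let $Y=(y,s)\in\mathbb R^{n}\times\mathbb R$, let $\omega\in A_{1+\frac1n}$ satisfy $$[\omega]_{A_{1+\frac1n}}\le K_0\quad\text{and}\quad[[\omega]]_{\mathrm{BMO}(B_{2r}(y),\omega)}\le\epsilon_2,$$ and let $(a_{ij})$ be measurable and symmetric in $C^h_{r,\mu}(Y)$ with $$\nu|\xi|^2\le \sum_{i,j=1}^n a_{ij}(x,t)\xi_i\xi_j,\qquad |a_{ij}(x,t)|\le\nu^{-1}$$ for all $\xi\in\mathbb R^n$, all $i,j$ and all $(x,t)\in C^h_{r,\mu}(Y)$. Let $u\in C^{2,1}(C^h_{r,\mu}(Y))\cap C(\overline{C^h_{r,\mu}(Y)})$ satisfy $\mathcal Lu\le0$ almost everywhere in $C^h_{r,\mu}(Y)$, and suppose that $$u(\cdot,\tau)\le0\quad\text{in }B_\rho(z)$$ for some $z\in\mathbb R^n$ and $\tau\in\mathbb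 R$ with $$B_\rho(z)\subset B_r(y)\quad\text{and}\quad s-hr^2(\mu)_{B_r(y)}^{1/n}\le\tau\le s-h\Big(\frac{r^2}2+\rho^2\Big)(\mu)_{B_r(y)}^{1/n}.$$ Then $$\sup_{C^h_{r/2,\mu}(Y)}u^+\le\beta_2\,\sup_{C^h_{r,\mu}(Y)}u^+ .$$ Here $u\in C^{2,1}(\Omega)$ means that $u$, $u_t$, $D_iu$, $D_{ij}u$ exist and are continuous in $\Omega$ for all $i,j$, and $u^+=\max\{u,0\}$. -/

import Mathlib

open MeasureTheory Metric Set
open scoped ENNReal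

namespace WeightedParabolic

/-- Euclidean space `ℝⁿ`. -/
abbrev Space (n : ℕ) : Type := EuclideanSpace ℝ (Fin n)

/-- Space-time `ℝⁿ × ℝ`, with points `X = (x, t)`. -/
abbrev SpaceTime (n : ℕ) : Type := Space n × ℝ

/-! ### Weights -/

/-- The mean `|B|⁻¹ ∫_B g dx` over the ball `B = B_ρ(x₀)`, for `g` with values in `[0, ∞]`. -/
noncomputable def meanENN {n : ℕ} (g : Space n → ℝ≥0∞) (x₀ : Space n) (ρ : ℝ) : ℝ≥0∞ :=
  (volume (ball x₀ ρ))⁻¹ * ∫⁻ x in ball x₀ ρ, g x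

/-- The `A_p` characteristic of a non-negative weight `σ`, for `1 < p < ∞`: the supremum over all
balls `B` of `(σ)_B * ((σ ^ (-1/(p-1)))_B) ^ (p-1)`, as an extended non-negative number
(so `σ ^ (-1/(p-1))` is `∞` where `σ = 0`). -/
noncomputable def apConst {n : ℕ} (p : ℝ) (σ : Space n → ℝ) : ℝ≥0∞ :=
  ⨆ (x₀ : Space n) (ρ : ℝ) (_ : 0 < ρ),
    meanENN (fun x => ENNReal.ofReal (σ x)) x₀ ρ *
      meanENN (fun x => ENNReal.ofReal (σ x) ^ (-(1 / (p - 1)))) x₀ ρ ^ (p - 1)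

/-- `σ` belongs to the Muckenhoupt class `A_p`, `1 < p < ∞`. As usual for a weight, `σ` is
non-negative, locally integrable, and positive almost everywhere (the last clause
only excludes `σ = 0` a.e.; otherwise it follows from finiteness of the characteristic). -/
structure MemAp {n : ℕ} (p : ℝ) (σ : Space n → ℝ) : Prop where
  nonneg : ∀ x, 0 ≤ σ x
  locallyIntegrable : LocallyIntegrable σ volume
  ae_pos : ∀ᵐ x ∂(volume : Measure (Space n)), 0 < σ x
  apConst_lt_top : apConst p σ < ∞

/-- The mean oscillation of `f` on the ball `B = B_r(y)` with respect to the weight `ω`: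
`(ω(B)⁻¹ ∫_B |f - (f)_B|^(n+1) ω^(-n) dx)^(1/(n+1))`. -/
noncomputable def meanOsc {n : ℕ} (f ω : Space n → ℝ) (y : Space n) (r : ℝ) : ℝ≥0∞ :=
  ((∫⁻ x in ball y r, ENNReal.ofReal (ω x))⁻¹ *
    ∫⁻ x in ball y r, ENNReal.ofReal (|f x - ⨍ z in ball y r, f z| ^ (n + 1)) *
      ((ENNReal.ofReal (ω x)) ^ n)⁻¹) ^ (1 / ((n : ℝ) + 1))

/-- The weighted BMO seminorm of `f` on `Ω` with respect to `ω`: the supremum of the mean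
oscillations over all balls contained in `Ω`. -/
noncomputable def bmoSeminorm {n : ℕ} (f ω : Space n → ℝ) (Ω : Set (Space n)) : ℝ≥0∞ :=
  ⨆ (y : Space n) (r : ℝ) (_ : 0 < r) (_ : ball y r ⊆ Ω), meanOsc f ω y r

/-- The weight `μ = ω ^ (-n)`. -/
noncomputable def dualWeight {n : ℕ} (ω : Space n → ℝ) : Space n → ℝ := fun x => (ω x ^ n)⁻¹

/-! ### Weighted cylinders -/

/-- `(μ)_{B_r(y)} ^ (1/n)`, where `(μ)_B` is the mean of `μ` on `B` for Lebesgue measure. -/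
noncomputable def timeScale {n : ℕ} (μ : Space n → ℝ) (r : ℝ) (y : Space n) : ℝ :=
  (⨍ x in ball y r, μ x) ^ (1 / (n : ℝ))

/-- The weighted cylinder
`C^h_{r,μ}(Y) = B_r(y) × (s - h r² (μ)_{B_r(y)}^{1/n}, s)`, `Y = (y, s)`. -/
def weightedCylinder {n : ℕ} (μ : Space n → ℝ) (h r : ℝ) (Y : SpaceTime n) : Set (SpaceTime n) :=
  ball Y.1 r ×ˢ Ioo (Y.2 - h * r ^ 2 * timeScale μ r Y.1) Y.2

/-! ### Partial derivatives and the operator -/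

/-- The time derivative `u_t`. -/
noncomputable def dt {n : ℕ} (u : SpaceTime n → ℝ) (X : SpaceTime n) : ℝ :=
  deriv (fun t => u (X.1, t)) X.2

/-- The space derivative `D_i u`. -/
noncomputable def dx {n : ℕ} (i : Fin n) (u : SpaceTime n → ℝ) (X : SpaceTime n) : ℝ :=
  lineDeriv ℝ (fun x => u (x, X.2)) X.1 (EuclideanSpace.single i 1)

/-- `D_i u` exists at `X`. -/
def HasDx {n : ℕ} (i : Fin n) (u : SpaceTime n → ℝ) (X : SpaceTime n) : Prop :=
  LineDifferentiableAt ℝ (fun x => u (x, X.2)) X.1 (EuclideanSpace.single i 1)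

/-- `u ∈ C^{2,1}(Ω)`: `u` is continuous in `Ω`, and `u_t`, `D_i u`, `D_{ij} u`
exist and are continuous in `Ω`. -/
structure IsC21On {n : ℕ} (u : SpaceTime n → ℝ) (Ω : Set (SpaceTime n)) : Prop where
  cont : ContinuousOn u Ω
  dt_exists : ∀ X ∈ Ω, DifferentiableAt ℝ (fun t => u (X.1, t)) X.2
  dt_cont : ContinuousOn (dt u) Ω
  dx_exists : ∀ i, ∀ X ∈ Ω, HasDx i u X
  dx_cont : ∀ i, ContinuousOn (dx i u) Ω
  dxx_exists : ∀ i j, ∀ X ∈ Ω, HasDx i (dx j u) X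
  dxx_cont : ∀ i j, ContinuousOn (dx i (dx j u)) Ω

/-- The coefficients `(a_ij)` are measurable in `Ω`, symmetric, and elliptic and bounded with
constant `ν`: `ν |ξ|² ≤ a_ij ξ_i ξ_j` and `|a_ij| ≤ ν⁻¹`. -/
structure IsElliptic {n : ℕ} (ν : ℝ) (a : SpaceTime n → Matrix (Fin n) (Fin n) ℝ)
    (Ω : Set (SpaceTime n)) : Prop where
  measurable : ∀ i j, AEMeasurable (fun X => a X i j) (volume.restrict Ω)
  symm : ∀ X ∈ Ω, (a X).IsSymm
  elliptic : ∀ X ∈ Ω, ∀ ξ : Space n, ν * ‖ξ‖ ^ 2 ≤ ∑ i, ∑ j, a X i j * ξ i * ξ j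
  bounded : ∀ X ∈ Ω, ∀ i j, |a X i j| ≤ ν⁻¹

/-- `ℒ u = u_t - ω(x) a_ij(x,t) D_ij u`. -/
noncomputable def parabolicOp {n : ℕ} (ω : Space n → ℝ)
    (a : SpaceTime n → Matrix (Fin n) (Fin n) ℝ) (u : SpaceTime n → ℝ) (X : SpaceTime n) : ℝ :=
  dt u X - ω X.1 * ∑ i, ∑ j, a X i j * dx i (dx j u) X

/-- `sup_Ω u⁺`, as an extended non-negative number. -/
noncomputable def supPos {n : ℕ} (u : SpaceTime n → ℝ) (Ω : Set (SpaceTime n)) : ℝ≥0∞ :=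
  ⨆ X ∈ Ω, ENNReal.ofReal (u X)

end WeightedParabolic

open WeightedParabolic

namespace WeightedParabolic

open Filter Topology NNReal

/-! Fix a point `(x₁, t₁)` of the half-size cylinder, let `M` be the supremum of `u⁺` on the large
one and `c = (ω)_B` on `B = B_r(y)`. Join `(z, τ)` to `(x₁, t₁)` by a slanted cylinder of radius `R
= ρ / 2`, contained in the large cylinder apart possibly from its base, which may lie on the bottom.
On it the barrier `v = exp(-λ(t-τ)/Θ) (1 - |ξ|²/R²)²`, with `Θ = t₁ - τ`, is a subsolution of the
operator in which `ω` is frozen at `c`, for `λ` depending only on the data (`barrier_subsolution`).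
The function `w = u + M v - M` is non-positive on the base, where `u ≤ 0` and `v ≤ 1`, and on the
lateral side, where `v = 0` and `u ≤ M`. Inside, `ℒ w ≤ M (c - ω) a_ij D_ij v`, which is at most a
constant times `M R⁻² |ω - c|`.

The parabolic Aleksandrov–Bakelman–Pucci–Krylov–Tso estimate then bounds `w(x₁, t₁)^(n+1)` by a
multiple of the integral of `|ω - c|^(n+1) ω^(-n)`, which is precisely the weighted oscillation. The
`A_{1+1/n}` bound makes the result scale invariant: `w(x₁, t₁) ≤ G ε M`. Since `v(x₁, t₁) =
exp(-λ)`, it follows that `u(x₁, t₁) ≤ (1 - exp(-λ) + G ε) M` (`growth_at_point`), and a small `ε`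
concludes.

The maximum principle (`volume_le_lintegral_contactSet`) measures the image of the upper contact set
under `X ↦ (Dw, w - Dw·(x - x₁))`. As `Dw` is only continuous in time, this map need not be
differentiable. The area formula is therefore applied on time slices to `x ↦ Dw(x, t)`, and for each
fixed slope time is exchanged for height by a one-dimensional Lipschitz bound whose constant is
essentially `w_t`. -/

/-! ### Length under Lipschitz relations on the line. -/

/-- A locally Lipschitz relation on `ℝ` increases length by at most the Lipschitz constant. -/
theorem volume_snd_image_le {R : Set (ℝ × ℝ)} {δ : ℝ} (hδ : 0 < δ) {C : ℝ≥0}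
    (hR : ∀ p ∈ R, ∀ q ∈ R, |p.1 - q.1| < δ → |p.2 - q.2| ≤ C * |p.1 - q.1|) :
    volume (Prod.snd '' R) ≤ C * volume (Prod.fst '' R) := by
  classical
  let I : ℤ → Set ℝ := fun i => Ico (i • δ) ((i + 1) • δ)
  have hI : ⋃ i, I i = univ := iUnion_Ico_zsmul hδ
  have hIdisj : Pairwise (Function.onFun Disjoint I) := pairwise_disjoint_Ico_zsmul δ
  have hIδ : ∀ i, ∀ a ∈ I i, ∀ b ∈ I i, |a - b| < δ := by
    intro i a ha b hb
    simp only [I, mem_Ico, zsmul_eq_mul, Int.cast_add, Int.cast_one] at ha hb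
    rw [abs_lt]; constructor <;> nlinarith [ha.1, ha.2, hb.1, hb.2]
  -- Two points of `R` with equal abscissae are at distance `0 < δ`, so `hR` equates their
  -- ordinates: `R` is the graph of `g` over its projection.
  let g : ℝ → ℝ := fun t => if h : ∃ k, (t, k) ∈ R then h.choose else 0
  have hg : ∀ p ∈ R, g p.1 = p.2 := by
    intro p hp
    have h : ∃ k, (p.1, k) ∈ R := ⟨p.2, hp⟩
    have h1 : (p.1, g p.1) ∈ R := by
      simp only [g, dif_pos h]; exact h.choose_spec
    have := hR _ h1 _ hp (by simpa using hδ)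
    simp only [sub_self, abs_zero, mul_zero] at this
    exact sub_eq_zero.1 (abs_nonpos_iff.1 this)
  -- `Prod.fst '' R` need not be measurable; the measure restricted to it is still countably
  -- additive over the intervals `I i`.
  have hpiece : ∀ i, volume (Prod.snd '' (R ∩ Prod.fst ⁻¹' I i)) ≤
      C * (volume.restrict (Prod.fst '' R)) (I i) := by
    intro i
    have e1 : Prod.snd '' (R ∩ Prod.fst ⁻¹' I i) = g '' (I i ∩ Prod.fst '' R) := by
      ext k; constructor
      · rintro ⟨p, ⟨hp, hpi⟩, rfl⟩
        exact ⟨p.1, ⟨hpi, p, hp, rfl⟩, hg p hp⟩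
      · rintro ⟨t, ⟨hti, p, hp, rfl⟩, rfl⟩
        exact ⟨p, ⟨hp, hti⟩, (hg p hp).symm⟩
    have hL : LipschitzOnWith C g (I i ∩ Prod.fst '' R) := by
      refine LipschitzOnWith.of_dist_le_mul ?_
      rintro _ ⟨ha, p, hp, rfl⟩ _ ⟨hb, p', hp', rfl⟩
      rw [hg p hp, hg p' hp', Real.dist_eq, Real.dist_eq]
      exact hR p hp p' hp' (hIδ i _ ha _ hb)
    have := hL.hausdorffMeasure_image_le (d := 1) zero_le_one
    rw [hausdorffMeasure_real] at this
    rw [e1, Measure.restrict_apply measurableSet_Ico]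
    simpa only [NNReal.coe_one, ENNReal.rpow_one] using this
  calc volume (Prod.snd '' R)
      ≤ volume (⋃ i, Prod.snd '' (R ∩ Prod.fst ⁻¹' I i)) := by
        refine measure_mono ?_
        rintro _ ⟨p, hp, rfl⟩
        have : p.1 ∈ ⋃ i, I i := by rw [hI]; trivial
        obtain ⟨i, hi⟩ := mem_iUnion.1 this
        exact mem_iUnion.2 ⟨i, p, ⟨hp, hi⟩, rfl⟩
    _ ≤ ∑' i, volume (Prod.snd '' (R ∩ Prod.fst ⁻¹' I i)) := measure_iUnion_le _
    _ ≤ ∑' i, C * (volume.restrict (Prod.fst '' R)) (I i) := ENNReal.tsum_le_tsum hpiece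
    _ = C * volume (Prod.fst '' R) := by
        rw [ENNReal.tsum_mul_left, ← measure_iUnion hIdisj (fun i => measurableSet_Ico), hI,
          Measure.restrict_apply_univ]

/-! ### Upper contact sets. -/

/-- `w` has the time derivative `wt`, the spatial gradient `Dw` and the spatial Hessian `A`, all of
them continuous, in `U`. -/
structure HasC21Derivs {n : ℕ} (U : Set (SpaceTime n)) (w wt : SpaceTime n → ℝ)
    (Dw : SpaceTime n → Space n) (A : SpaceTime n → Space n →L[ℝ] Space n) : Prop where
  cont_time : ContinuousOn wt U
  cont_grad : ContinuousOn Dw U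
  cont_hess : ContinuousOn A U
  hasDerivAt : ∀ X ∈ U, HasDerivAt (fun t => w (X.1, t)) (wt X) X.2
  hasGrad : ∀ X ∈ U, HasFDerivAt (fun x => w (x, X.2)) (innerSL ℝ (Dw X)) X.1
  hasHess : ∀ X ∈ U, HasFDerivAt (fun x => Dw (x, X.2)) (A X) X.1

/-- Data for the parabolic maximum principle: `w` is continuous on the compact set `K`, whose
latest points have time at most `T`, and is `C^{2,1}` on the open set `U`; outside `U` it is
non-positive on `K`. -/
structure ContactData {n : ℕ} (K U : Set (SpaceTime n)) (T : ℝ) (w wt : SpaceTime n → ℝ)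
    (Dw : SpaceTime n → Space n) (A : SpaceTime n → Space n →L[ℝ] Space n) : Prop
    extends HasC21Derivs U w wt Dw A where
  isCompact : IsCompact K
  isOpen : IsOpen U
  mem_of_le : ∀ X ∈ U, X.2 ≤ T → X ∈ K
  le_of_mem : ∀ X ∈ K, X.2 ≤ T
  mem_of_pos : ∀ X ∈ K, 0 < w X → X ∈ U
  cont : ContinuousOn w K

/-- The part of the upper contact set of `w` over `K` where `w ≥ c`. -/
def contactSet {n : ℕ} (K : Set (SpaceTime n)) (w : SpaceTime n → ℝ) (Dw : SpaceTime n → Space n)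
    (c : ℝ) : Set (SpaceTime n) :=
  {X ∈ K | c ≤ w X ∧ ∀ Y ∈ K, Y.2 < X.2 → w Y ≤ w X + inner ℝ (Dw X) (Y.1 - X.1)}

namespace ContactData

variable {n : ℕ} {K U : Set (SpaceTime n)} {T : ℝ} {w wt : SpaceTime n → ℝ}
  {Dw : SpaceTime n → Space n} {A : SpaceTime n → Space n →L[ℝ] Space n}

theorem isCompact_superlevel (H : ContactData K U T w wt Dw A) (c : ℝ) :
    IsCompact {X ∈ K | c ≤ w X} := by
  have := H.cont.preimage_isClosed_of_isClosed H.isCompact.isClosed (isClosed_Ici (a := c))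
  exact H.isCompact.of_isClosed_subset this (fun X hX => hX.1)

theorem superlevel_subset (H : ContactData K U T w wt Dw A) {c : ℝ} (hc : 0 < c) :
    {X ∈ K | c ≤ w X} ⊆ U := fun X hX => H.mem_of_pos X hX.1 (hc.trans_le hX.2)

theorem contactSet_subset (H : ContactData K U T w wt Dw A) {c : ℝ} (hc : 0 < c) :
    contactSet K w Dw c ⊆ U := fun _ hX => H.superlevel_subset hc ⟨hX.1, hX.2.1⟩

/-- Closedness relies on the strict inequality `Y.2 < X.2` in the definition: a competitor strictly
earlier than the limit is strictly earlier than nearby contact points too. -/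
theorem isCompact_contactSet (H : ContactData K U T w wt Dw A) {c : ℝ} (hc : 0 < c) :
    IsCompact (contactSet K w Dw c) := by
  have hK := H.isCompact_superlevel c
  refine hK.of_isClosed_subset ?_ (fun X hX => ⟨hX.1, hX.2.1⟩)
  refine isClosed_of_closure_subset fun X hX => ?_
  have hsub : contactSet K w Dw c ⊆ {X ∈ K | c ≤ w X} := fun X hX => ⟨hX.1, hX.2.1⟩
  have hXK : X ∈ {X ∈ K | c ≤ w X} := closure_minimal hsub hK.isClosed hX
  have hXU := H.superlevel_subset hc hXK
  refine ⟨hXK.1, hXK.2, fun Y hY hYX => ?_⟩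
  obtain ⟨Z, hZ, hZX⟩ := mem_closure_iff_seq_limit.1 hX
  have hZK : Tendsto Z atTop (𝓝[K] X) :=
    tendsto_nhdsWithin_iff.2 ⟨hZX, Eventually.of_forall fun k => (hZ k).1⟩
  have h1 : Tendsto (fun k => w (Z k)) atTop (𝓝 (w X)) := (H.cont X hXK.1).tendsto.comp hZK
  have h2 : Tendsto (fun k => Dw (Z k)) atTop (𝓝 (Dw X)) :=
    (H.cont_grad.continuousAt (H.isOpen.mem_nhds hXU)).tendsto.comp hZX
  have h3 : Tendsto (fun k => (Z k).1) atTop (𝓝 X.1) := (continuous_fst.tendsto X).comp hZX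
  have h4 : Tendsto (fun k => (Z k).2) atTop (𝓝 X.2) := (continuous_snd.tendsto X).comp hZX
  refine ge_of_tendsto (h1.add (h2.inner (tendsto_const_nhds.sub h3))) ?_
  filter_upwards [h4.eventually (lt_mem_nhds hYX)] with k hk
  exact (hZ k).2.2 Y hY hk

theorem eventually_mem_left (H : ContactData K U T w wt Dw A) {Y : SpaceTime n} (hY : Y ∈ U)
    (hYT : Y.2 ≤ T) : ∀ᶠ t in 𝓝[<] Y.2, (Y.1, t) ∈ U ∧ (Y.1, t) ∈ K ∧ t < Y.2 := by
  have hc : Continuous fun t : ℝ => (Y.1, t) := by fun_prop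
  have h1 : ∀ᶠ t in 𝓝 Y.2, (Y.1, t) ∈ U := hc.continuousAt.eventually_mem (H.isOpen.mem_nhds hY)
  filter_upwards [nhdsWithin_le_nhds h1, self_mem_nhdsWithin] with t ht1 ht2
  exact ⟨ht1, H.mem_of_le _ ht1 (ht2.le.trans hYT), ht2⟩

/-- Continuity of `w` in time extends the supporting inequality from strictly earlier points to
simultaneous ones, which the spatial arguments need. -/
theorem contact_le (H : ContactData K U T w wt Dw A) {c : ℝ} {X Y : SpaceTime n}
    (hX : X ∈ contactSet K w Dw c) (hY : Y ∈ U) (hYX : Y.2 ≤ X.2) :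
    w Y ≤ w X + inner ℝ (Dw X) (Y.1 - X.1) := by
  have h1 : Tendsto (fun t => w (Y.1, t)) (𝓝[<] Y.2) (𝓝 (w Y)) :=
    (H.hasDerivAt Y hY).continuousAt.tendsto.mono_left nhdsWithin_le_nhds
  refine le_of_tendsto h1 ?_
  filter_upwards [H.eventually_mem_left hY (hYX.trans (H.le_of_mem X hX.1))] with t ht
  exact hX.2.2 (Y.1, t) ht.2.1 (ht.2.2.trans_le hYX)

theorem time_deriv_nonneg (H : ContactData K U T w wt Dw A) {c : ℝ} (hc : 0 < c)
    {X : SpaceTime n} (hX : X ∈ contactSet K w Dw c) : 0 ≤ wt X := by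
  have hXU := H.contactSet_subset hc hX
  have h := (H.hasDerivAt X hXU).tendsto_slope
  have h' : Tendsto (slope (fun t => w (X.1, t)) X.2) (𝓝[<] X.2) (𝓝 (wt X)) :=
    h.mono_left (nhdsWithin_mono _ fun t ht => ne_of_lt ht)
  refine ge_of_tendsto h' ?_
  filter_upwards [H.eventually_mem_left hXU (H.le_of_mem X hX.1)] with t ht
  have := hX.2.2 (X.1, t) ht.2.1 ht.2.2
  simp only [sub_self, inner_zero_right, add_zero] at this
  rw [slope_def_field]
  exact div_nonneg_of_nonpos (by simpa using this) (by linarith [ht.2.2])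

/-- If the second derivative along `η` were positive, the second derivative test would give a local
minimum where contact gives a local maximum; the restriction would be locally constant, with zero
second derivative. -/
theorem hess_nonpos (H : ContactData K U T w wt Dw A) {c : ℝ} (hc : 0 < c)
    {X : SpaceTime n} (hX : X ∈ contactSet K w Dw c) (η : Space n) :
    inner ℝ (A X η) η ≤ 0 := by
  have hXU := H.contactSet_subset hc hX
  by_contra! hpos
  -- restrict to the line through `X` in the direction `η`
  let φ : ℝ → ℝ := fun s => w (X.1 + s • η, X.2) - s * inner ℝ (Dw X) η
  have hline : ∀ s : ℝ, HasDerivAt (fun s : ℝ => X.1 + s • η) η s := fun s => by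
    simpa using ((hasDerivAt_id s).smul_const η).const_add X.1
  have hc' : Continuous fun s : ℝ => ((X.1 + s • η, X.2) : SpaceTime n) := by fun_prop
  have hU : ∀ᶠ s in 𝓝 (0 : ℝ), ((X.1 + s • η, X.2) : SpaceTime n) ∈ U :=
    hc'.continuousAt.eventually_mem (by simpa using H.isOpen.mem_nhds hXU)
  have hφ' : ∀ s : ℝ, ((X.1 + s • η, X.2) : SpaceTime n) ∈ U → HasDerivAt φ
      (inner ℝ (Dw (X.1 + s • η, X.2)) η - inner ℝ (Dw X) η) s := by
    intro s hs
    have h1 := (H.hasGrad _ hs).comp_hasDerivAt s (hline s)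
    have h2 := (hasDerivAt_id s).mul_const (inner ℝ (Dw X) η)
    simpa using! h1.sub h2
  have hd1 : deriv φ =ᶠ[𝓝 0] fun s : ℝ =>
      inner ℝ (Dw (X.1 + s • η, X.2)) η - inner ℝ (Dw X) η := by
    filter_upwards [hU] with s hs using (hφ' s hs).deriv
  have hd2 : HasDerivAt (fun s : ℝ => inner ℝ (Dw (X.1 + s • η, X.2)) η - inner ℝ (Dw X) η)
      (inner ℝ (A X η) η) 0 := by
    have hh : HasFDerivAt (fun x => Dw (x, X.2)) (A X) (X.1 + (0 : ℝ) • η) := by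
      simpa using H.hasHess X hXU
    have h1 := hh.comp_hasDerivAt (0 : ℝ) (hline 0)
    have h2 := h1.inner ℝ (hasDerivAt_const (0 : ℝ) η)
    simpa using! h2.sub_const (inner ℝ (Dw X) η)
  have hdd : deriv (deriv φ) 0 = inner ℝ (A X η) η := by
    rw [hd1.deriv_eq]; exact hd2.deriv
  have hmin : IsLocalMin φ 0 := by
    refine isLocalMin_of_deriv_deriv_pos (by rw [hdd]; exact hpos) ?_ ?_
    · rw [hd1.eq_of_nhds]; simp
    · exact (hφ' 0 (by simpa using hXU)).continuousAt
  have hmax : ∀ᶠ s in 𝓝 (0 : ℝ), φ s ≤ φ 0 := by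
    filter_upwards [hU] with s hs
    have := H.contact_le hX hs le_rfl
    simp only [add_sub_cancel_left, inner_smul_right] at this
    simp only [φ, zero_smul, add_zero, zero_mul, sub_zero]
    linarith
  have hconst : φ =ᶠ[𝓝 0] fun _ => φ 0 := by
    filter_upwards [hmax, hmin] with s h1 h2 using le_antisymm h1 h2
  have : deriv (deriv φ) 0 = 0 := by
    rw [hconst.deriv.deriv_eq]; simp
  linarith [hdd]

/-- Every affine function of small slope and height between `m / 2` and `m` touches `w` from above
at a point of the contact set. -/
theorem exists_contact (H : ContactData K U T w wt Dw A) {X₁ : SpaceTime n} (hX₁ : X₁ ∈ K)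
    {m d : ℝ} (hm : 0 < m) (hd : 0 < d) (hwm : w X₁ = m) (hdiam : ∀ X ∈ K, ‖X.1 - X₁.1‖ ≤ d)
    {ξ : Space n} (hξ : ‖ξ‖ < m / (4 * d)) {k : ℝ} (hk : m / 2 ≤ k) (hkm : k < m) :
    ∃ X ∈ contactSet K w Dw (m / 4), Dw X = ξ ∧ w X - inner ℝ (Dw X) (X.1 - X₁.1) = k := by
  let V : SpaceTime n → ℝ := fun X => w X - inner ℝ ξ (X.1 - X₁.1)
  have hV : ContinuousOn V K := H.cont.sub (by fun_prop)
  have hSc : IsCompact {X ∈ K | k ≤ V X} :=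
    H.isCompact.of_isClosed_subset
      (hV.preimage_isClosed_of_isClosed H.isCompact.isClosed (isClosed_Ici (a := k)))
      fun X hX => hX.1
  have hSne : {X ∈ K | k ≤ V X}.Nonempty := ⟨X₁, hX₁, by simp [V, hwm, hkm.le]⟩
  -- The slope bound lets the linear term cost at most `m / 4`, so height `m / 2` leaves `w ≥ m / 4
  -- > 0` and excludes points outside `U`.
  have hlow : ∀ X ∈ K, k ≤ V X → m / 4 ≤ w X := by
    intro X hX hkX
    have h1 : |inner ℝ ξ (X.1 - X₁.1)| ≤ ‖ξ‖ * ‖X.1 - X₁.1‖ := abs_real_inner_le_norm _ _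
    have h2 : ‖ξ‖ * ‖X.1 - X₁.1‖ ≤ m / (4 * d) * d :=
      mul_le_mul hξ.le (hdiam X hX) (norm_nonneg _) (by positivity)
    have h3 : m / (4 * d) * d = m / 4 := by field_simp
    have h4 := (abs_le.1 h1).1
    simp only [V] at hkX
    linarith
  have hmemU : ∀ X ∈ K, k ≤ V X → X ∈ U := fun X hX hkX =>
    H.mem_of_pos X hX (by linarith [hlow X hX hkX])
  -- The contact point is the earliest point where `V` reaches `k`. By continuity `V ≤ k` up to that
  -- time, so `V X = k` is a spatial local maximum and the gradient of `V` vanishes.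
  obtain ⟨X, hX, hXmin⟩ := hSc.exists_isMinOn hSne continuous_snd.continuousOn
  have hXU := hmemU X hX.1 hX.2
  have hearly : ∀ Y ∈ K, Y.2 < X.2 → V Y < k := by
    intro Y hY hYX
    by_contra! hcon
    exact absurd (hXmin (show Y ∈ {X ∈ K | k ≤ V X} from ⟨hY, hcon⟩)) (not_le.2 hYX)
  have hXT := H.le_of_mem X hX.1
  have hle : ∀ Y ∈ U, Y.2 ≤ X.2 → V Y ≤ k := by
    intro Y hY hYX
    have h1 : Tendsto (fun t => V (Y.1, t)) (𝓝[<] Y.2) (𝓝 (V Y)) :=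
      ((H.hasDerivAt Y hY).continuousAt.tendsto.mono_left nhdsWithin_le_nhds).sub
        tendsto_const_nhds
    refine le_of_tendsto h1 ?_
    filter_upwards [H.eventually_mem_left hY (hYX.trans hXT)] with t ht
    exact (hearly (Y.1, t) ht.2.1 (ht.2.2.trans_le hYX)).le
  have hVX : V X = k := le_antisymm (hle X hXU le_rfl) hX.2
  have hgrad : Dw X = ξ := by
    have h1 : HasFDerivAt (fun x => V (x, X.2)) (innerSL ℝ (Dw X) - innerSL ℝ ξ) X.1 := by
      have h2 : HasFDerivAt (fun x : Space n => inner ℝ ξ (x - X₁.1)) (innerSL ℝ ξ) X.1 := by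
        have := (innerSL ℝ ξ).hasFDerivAt.comp X.1 ((hasFDerivAt_id X.1).sub_const X₁.1)
        simpa using! this
      exact (H.hasGrad X hXU).sub h2
    have h3 : IsLocalMax (fun x => V (x, X.2)) X.1 := by
      have hc : Continuous fun x : Space n => (x, X.2) := by fun_prop
      have : ∀ᶠ x in 𝓝 X.1, (x, X.2) ∈ U := hc.continuousAt.eventually_mem (H.isOpen.mem_nhds hXU)
      filter_upwards [this] with x hx
      exact (hle _ hx le_rfl).trans hVX.ge
    have h4 := h3.hasFDerivAt_eq_zero h1
    rw [← map_sub] at h4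
    have h5 := DFunLike.congr_fun h4 (Dw X - ξ)
    simp only [innerSL_apply_apply, zero_apply, inner_self_eq_zero] at h5
    exact sub_eq_zero.1 h5
  refine ⟨X, ⟨hX.1, hlow X hX.1 hX.2, fun Y hY hYX => ?_⟩, hgrad, by rw [hgrad]; exact hVX⟩
  have h1 := (hearly Y hY hYX).le.trans hVX.ge
  have h2 : inner ℝ ξ (Y.1 - X.1) = inner ℝ ξ (Y.1 - X₁.1) - inner ℝ ξ (X.1 - X₁.1) := by
    rw [← inner_sub_right]; congr 1; abel
  rw [hgrad, h2]
  simp only [V] at h1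
  linarith

/-- The time segment between two contact points may leave the contact set; this keeps it in `U` with
`wt` under control, at the price of `ε`. -/
theorem exists_uniform_radius (H : ContactData K U T w wt Dw A) {c : ℝ} (hc : 0 < c) {ε : ℝ}
    (hε : 0 < ε) : ∃ δ > 0, ∀ X ∈ contactSet K w Dw c, ∀ Y : SpaceTime n, dist X Y < δ →
      Y ∈ U ∧ wt Y ≤ wt X + ε := by
  have hK := H.isCompact_contactSet hc
  have hKU := H.contactSet_subset hc
  obtain ⟨δ₁, hδ₁, h1⟩ := hK.exists_thickening_subset_open H.isOpen hKU
  have h2 := hK.uniformContinuousAt_of_continuousAt wt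
    (fun X hX => H.cont_time.continuousAt (H.isOpen.mem_nhds (hKU hX)))
    (Metric.dist_mem_uniformity hε)
  obtain ⟨δ₂, hδ₂, h3⟩ := Metric.mem_uniformity_dist.1 h2
  refine ⟨min δ₁ δ₂, lt_min hδ₁ hδ₂, fun X hX Y hXY => ⟨h1 ?_, ?_⟩⟩
  · rw [mem_thickening_iff]
    exact ⟨X, hX, by rw [dist_comm]; exact hXY.trans_le (min_le_left _ _)⟩
  · have : dist (wt X) (wt Y) < ε := h3 (hXY.trans_le (min_le_right _ _)) hX
    rw [Real.dist_eq] at this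
    linarith [(abs_lt.1 this).1]

/-- Heights of supporting affine functions with a common slope are monotone and locally Lipschitz
in time. -/
theorem abs_height_sub_le (H : ContactData K U T w wt Dw A) {c : ℝ} {b ε δ : ℝ}
    (hδ : ∀ X ∈ contactSet K w Dw c, ∀ Y : SpaceTime n, dist X Y < δ → Y ∈ U ∧ wt Y ≤ wt X + ε)
    {X X' : SpaceTime n} (hX : X ∈ contactSet K w Dw c) (hX' : X' ∈ contactSet K w Dw c)
    (hXU : X ∈ U) (hbX' : wt X' ≤ b) (hDw : Dw X = Dw X') (hle : X.2 ≤ X'.2)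
    (hlt : |X.2 - X'.2| < δ) (x₁ : Space n) :
    |(w X - inner ℝ (Dw X) (X.1 - x₁)) - (w X' - inner ℝ (Dw X') (X'.1 - x₁))|
      ≤ (b + ε) * |X.2 - X'.2| := by
  have hsplit : ∀ ξ p q : Space n, inner ℝ ξ (p - q) = inner ℝ ξ (p - x₁) - inner ℝ ξ (q - x₁) := by
    intro ξ p q
    rw [← inner_sub_right]; congr 1; abel
  have hseg : ∀ t ∈ Icc X.2 X'.2, (X'.1, t) ∈ U ∧ wt (X'.1, t) ≤ b + ε := by
    intro t ht
    have hd : dist X' (X'.1, t) < δ := by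
      rw [Prod.dist_eq, dist_self, Real.dist_eq]
      refine max_lt ((abs_nonneg _).trans_lt hlt) (lt_of_le_of_lt ?_ hlt)
      rw [abs_of_nonneg (by linarith [ht.2]), abs_of_nonpos (by linarith)]
      linarith [ht.1]
    exact ⟨(hδ X' hX' _ hd).1, by linarith [(hδ X' hX' _ hd).2]⟩
  -- `h1` says that the later height is at least the earlier one. `h2` tests the contact at `X` at
  -- the point of its time level lying under `X'`, so the increase of height is at most the increase
  -- of `w` along a vertical segment.
  have h1 : w X ≤ w X' + inner ℝ (Dw X') (X.1 - X'.1) := H.contact_le hX' hXU hle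
  have h2 : w (X'.1, X.2) ≤ w X + inner ℝ (Dw X) (X'.1 - X.1) :=
    H.contact_le hX (hseg X.2 (left_mem_Icc.2 hle)).1 le_rfl
  have h3 : w X' - w (X'.1, X.2) ≤ (b + ε) * (X'.2 - X.2) := by
    have := (convex_Icc X.2 X'.2).image_sub_le_mul_sub_of_deriv_le (f := fun t => w (X'.1, t))
      (C := b + ε)
      (fun t ht => (H.hasDerivAt (X'.1, t) (hseg t ht).1).continuousAt.continuousWithinAt)
      (fun t ht => (H.hasDerivAt (X'.1, t)
        (hseg t (interior_subset ht)).1).differentiableAt.differentiableWithinAt)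
      (fun t ht => by
        rw [(H.hasDerivAt (X'.1, t) (hseg t (interior_subset ht)).1).deriv]
        exact (hseg t (interior_subset ht)).2)
      X.2 (left_mem_Icc.2 hle) X'.2 (right_mem_Icc.2 hle) hle
    exact this
  rw [hsplit] at h1 h2
  rw [hDw] at h2 ⊢
  rw [abs_of_nonpos (by linarith), abs_of_nonpos (by linarith : X.2 - X'.2 ≤ 0)]
  linarith

/-- The image of a piece of the contact set under the slope-height map has volume bounded by the
time derivative times the integral of the Hessian determinant. -/
theorem volume_slope_height_le (H : ContactData K U T w wt Dw A) {c : ℝ} (hc : 0 < c)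
    {B : Set (SpaceTime n)} (hB : IsCompact B) (hBc : B ⊆ contactSet K w Dw c)
    {b ε : ℝ} (hb : 0 ≤ b) (hε : 0 < ε) (hBb : ∀ X ∈ B, wt X ≤ b) (x₁ : Space n) :
    volume ((fun X : SpaceTime n => (Dw X, w X - inner ℝ (Dw X) (X.1 - x₁))) '' B) ≤
      ENNReal.ofReal (b + ε) * ∫⁻ X in B, ENNReal.ofReal |(A X).det| := by
  have hBU : B ⊆ U := hBc.trans (H.contactSet_subset hc)
  obtain ⟨δ, hδ, hδ'⟩ := H.exists_uniform_radius hc hε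
  -- `S` records slope and time, `E` slope and height. The fibres of `E` are compared with those of
  -- `S`, and the time slices of `S` are handled by the spatial area formula.
  let S : Set (Space n × ℝ) := (fun X : SpaceTime n => (Dw X, X.2)) '' B
  let E : Set (Space n × ℝ) :=
    (fun X : SpaceTime n => (Dw X, w X - inner ℝ (Dw X) (X.1 - x₁))) '' B
  have hDwB : ContinuousOn Dw B := H.cont_grad.mono hBU
  have hwB : ContinuousOn w B := H.cont.mono fun X hX => (hBc hX).1
  have hS : MeasurableSet S :=
    (hB.image_of_continuousOn (hDwB.prodMk continuous_snd.continuousOn)).measurableSet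
  have hE : MeasurableSet E :=
    (hB.image_of_continuousOn (hDwB.prodMk (hwB.sub (hDwB.inner (by fun_prop))))).measurableSet
  have hslice : ∀ ξ : Space n, volume (Prod.mk ξ ⁻¹' E) ≤
      ENNReal.ofReal (b + ε) * volume (Prod.mk ξ ⁻¹' S) := by
    intro ξ
    let R : Set (ℝ × ℝ) :=
      (fun X : SpaceTime n => (X.2, w X - inner ℝ (Dw X) (X.1 - x₁))) '' {X ∈ B | Dw X = ξ}
    have hR : ∀ p ∈ R, ∀ q ∈ R, |p.1 - q.1| < δ →
        |p.2 - q.2| ≤ (b + ε).toNNReal * |p.1 - q.1| := by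
      rintro _ ⟨X, ⟨hX, hXξ⟩, rfl⟩ _ ⟨X', ⟨hX', hXξ'⟩, rfl⟩ hlt
      rw [Real.coe_toNNReal _ (by linarith)]
      dsimp only at hlt ⊢
      rcases le_total X.2 X'.2 with hle | hle
      · exact H.abs_height_sub_le hδ' (hBc hX) (hBc hX') (hBU hX) (hBb X' hX')
          (hXξ.trans hXξ'.symm) hle hlt x₁
      · rw [abs_sub_comm, abs_sub_comm X.2]
        exact H.abs_height_sub_le hδ' (hBc hX') (hBc hX) (hBU hX') (hBb X hX)
          (hXξ'.trans hXξ.symm) hle (by rwa [abs_sub_comm]) x₁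
    have e1 : Prod.snd '' R = Prod.mk ξ ⁻¹' E := by
      ext k; constructor
      · rintro ⟨_, ⟨X, ⟨hX, rfl⟩, rfl⟩, rfl⟩; exact ⟨X, hX, rfl⟩
      · rintro ⟨X, hX, h⟩
        obtain ⟨h1, h2⟩ := Prod.mk.inj h
        exact ⟨_, ⟨X, ⟨hX, h1⟩, rfl⟩, h2⟩
    have e2 : Prod.fst '' R = Prod.mk ξ ⁻¹' S := by
      ext k; constructor
      · rintro ⟨_, ⟨X, ⟨hX, rfl⟩, rfl⟩, rfl⟩; exact ⟨X, hX, rfl⟩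
      · rintro ⟨X, hX, h⟩
        obtain ⟨h1, h2⟩ := Prod.mk.inj h
        exact ⟨_, ⟨X, ⟨hX, h1⟩, rfl⟩, h2⟩
    have := volume_snd_image_le hδ hR
    rwa [e1, e2] at this
  have hSle : volume S ≤ ∫⁻ X in B, ENNReal.ofReal |(A X).det| := by
    have hdet : ContinuousOn (fun X => |(A X).det|) U :=
      (ContinuousLinearMap.continuous_det.comp_continuousOn H.cont_hess).abs
    have hm : AEMeasurable (fun X => ENNReal.ofReal |(A X).det|) (volume.restrict B) :=
      ((hdet.mono hBU).aemeasurable hB.measurableSet).ennreal_ofReal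
    have hBm := hB.measurableSet
    rw [← lintegral_indicator hBm, Measure.volume_eq_prod,
      lintegral_prod_symm _ ((aemeasurable_indicator_iff hBm).2 hm),
      Measure.prod_apply_symm hS]
    refine lintegral_mono fun t => ?_
    have hBt : MeasurableSet {x : Space n | (x, t) ∈ B} := measurable_prodMk_right hBm
    have e : (fun ξ => (ξ, t)) ⁻¹' S = (fun x => Dw (x, t)) '' {x : Space n | (x, t) ∈ B} := by
      ext ξ; constructor
      · rintro ⟨⟨x, t'⟩, hX, h⟩
        obtain ⟨h1, h2⟩ := Prod.mk.inj h
        dsimp only at h2; subst h2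
        exact ⟨x, hX, h1⟩
      · rintro ⟨x, hx, rfl⟩; exact ⟨(x, t), hx, rfl⟩
    rw [e]
    refine (addHaar_image_le_lintegral_abs_det_fderiv volume hBt
      (f' := fun x => A (x, t)) fun x hx =>
        (H.hasHess (x, t) (hBU hx)).hasFDerivWithinAt).trans (le_of_eq ?_)
    rw [← lintegral_indicator hBt]
    rfl
  calc volume E = ∫⁻ ξ, volume (Prod.mk ξ ⁻¹' E) := by
        rw [Measure.volume_eq_prod, Measure.prod_apply hE]
    _ ≤ ∫⁻ ξ, ENNReal.ofReal (b + ε) * volume (Prod.mk ξ ⁻¹' S) := lintegral_mono hslice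
    _ = ENNReal.ofReal (b + ε) * volume S := by
        rw [lintegral_const_mul _ (measurable_measure_prodMk_left hS), Measure.volume_eq_prod,
          Measure.prod_apply hS]
    _ ≤ _ := by gcongr

end ContactData

/-! ### The integral maximum principle. -/

/-- A point lies in at most two of the intervals `[jε, (j+1)ε]`. -/
theorem sum_indicator_Icc_le_two {ε : ℝ} (hε : 0 < ε) (N : ℕ) (x : ℝ) :
    ∑ j ∈ Finset.range N, (Icc ((j : ℝ) * ε) ((j + 1) * ε)).indicator (fun _ => (1 : ℝ≥0∞)) x
      ≤ 2 := by
  classical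
  simp only [indicator_apply, Finset.sum_boole]
  have hsub : Finset.filter (fun j : ℕ => x ∈ Icc ((j : ℝ) * ε) ((j + 1) * ε)) (Finset.range N)
      ⊆ {⌊x / ε⌋₊, ⌊x / ε⌋₊ - 1} := by
    intro j hj
    obtain ⟨h1, h2⟩ := (Finset.mem_filter.1 hj).2
    have h3 : (j : ℝ) ≤ x / ε := (le_div_iff₀ hε).2 h1
    have h4 : x / ε ≤ j + 1 := (div_le_iff₀ hε).2 h2
    have h5 : j ≤ ⌊x / ε⌋₊ := Nat.le_floor h3
    have h6 : (⌊x / ε⌋₊ : ℝ) ≤ j + 1 := (Nat.floor_le (le_trans (by positivity) h3)).trans h4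
    have h7 : ⌊x / ε⌋₊ ≤ j + 1 := by exact_mod_cast h6
    simp only [Finset.mem_insert, Finset.mem_singleton]
    omega
  have hcard := (Finset.card_le_card hsub).trans Finset.card_le_two
  exact_mod_cast hcard

namespace ContactData
variable {n : ℕ} {K U : Set (SpaceTime n)} {T : ℝ} {w wt : SpaceTime n → ℝ}
  {Dw : SpaceTime n → Space n} {A : SpaceTime n → Space n →L[ℝ] Space n}

/-- The integral form of the parabolic Aleksandrov–Bakelman–Pucci–Krylov–Tso estimate. -/
theorem volume_le_lintegral_contactSet (H : ContactData K U T w wt Dw A) {X₁ : SpaceTime n}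
    (hX₁ : X₁ ∈ K) {m d : ℝ} (hm : 0 < m) (hd : 0 < d) (hwm : w X₁ = m)
    (hdiam : ∀ X ∈ K, ‖X.1 - X₁.1‖ ≤ d) :
    volume (ball (0 : Space n) (m / (4 * d))) * ENNReal.ofReal (m / 2) ≤
      2 * ∫⁻ X in contactSet K w Dw (m / 4), ENNReal.ofReal (wt X) * ENNReal.ofReal |(A X).det| := by
  have hm4 : 0 < m / 4 := by positivity
  set Γ := contactSet K w Dw (m / 4) with hΓ
  have hΓc : IsCompact Γ := H.isCompact_contactSet hm4
  have hΓU : Γ ⊆ U := H.contactSet_subset hm4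
  have hwtΓ : ContinuousOn wt Γ := H.cont_time.mono hΓU
  have hdetΓ : ContinuousOn (fun X => |(A X).det|) Γ :=
    (ContinuousLinearMap.continuous_det.comp_continuousOn (H.cont_hess.mono hΓU)).abs
  have hdetm : AEMeasurable (fun X => ENNReal.ofReal |(A X).det|) (volume.restrict Γ) :=
    (hdetΓ.aemeasurable hΓc.measurableSet).ennreal_ofReal
  have hwtm : AEMeasurable (fun X => ENNReal.ofReal (wt X)) (volume.restrict Γ) :=
    (hwtΓ.aemeasurable hΓc.measurableSet).ennreal_ofReal
  set I := ∫⁻ X in Γ, ENNReal.ofReal |(A X).det| with hI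
  have hIfin : I ≠ ∞ := by
    have := (hdetΓ.integrableOn_compact hΓc (μ := volume)).lintegral_lt_top
    exact this.ne
  obtain ⟨L, hL⟩ : ∃ L, ∀ X ∈ Γ, wt X ≤ L := by
    obtain ⟨L, hL⟩ := hΓc.bddAbove_image hwtΓ
    exact ⟨L, fun X hX => hL ⟨X, hX, rfl⟩⟩
  have key : ∀ ε : ℝ, 0 < ε → volume (ball (0 : Space n) (m / (4 * d))) * ENNReal.ofReal (m / 2) ≤
      2 * (∫⁻ X in Γ, ENNReal.ofReal (wt X) * ENNReal.ofReal |(A X).det|)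
        + ENNReal.ofReal ε * (4 * I) := by
    intro ε hε
    -- Closed bands of values of `wt` keep the pieces compact; they share endpoints, whence the
    -- factor 2.
    let B : ℕ → Set (SpaceTime n) := fun j => {X ∈ Γ | wt X ∈ Icc ((j : ℝ) * ε) ((j + 1) * ε)}
    let Φ : SpaceTime n → Space n × ℝ := fun X => (Dw X, w X - inner ℝ (Dw X) (X.1 - X₁.1))
    have hBc : ∀ j, IsCompact (B j) := fun j => hΓc.of_isClosed_subset
      (hwtΓ.preimage_isClosed_of_isClosed hΓc.isClosed isClosed_Icc) fun X hX => hX.1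
    obtain ⟨N, hN⟩ := exists_nat_gt (L / ε)
    have hcover : ball (0 : Space n) (m / (4 * d)) ×ˢ Ico (m / 2) m ⊆
        ⋃ j ∈ Finset.range N, Φ '' B j := by
      rintro ⟨ξ, k⟩ ⟨hξ, hk⟩
      obtain ⟨X, hX, h1, h2⟩ := H.exists_contact hX₁ hm hd hwm hdiam
        (by simpa using hξ) hk.1 hk.2
      have hwt0 := H.time_deriv_nonneg hm4 hX
      have hj : ⌊wt X / ε⌋₊ < N := by
        have : (⌊wt X / ε⌋₊ : ℝ) < N :=
          (Nat.floor_le (by positivity)).trans_lt (lt_of_le_of_lt (by gcongr; exact hL X hX) hN)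
        exact_mod_cast this
      refine mem_iUnion₂.2 ⟨⌊wt X / ε⌋₊, Finset.mem_range.2 hj, X, ⟨hX, ?_, ?_⟩, ?_⟩
      · exact (le_div_iff₀ hε).1 (Nat.floor_le (by positivity))
      · exact (div_le_iff₀ hε).1 (Nat.lt_floor_add_one _).le
      · simp only [Φ, Prod.mk.injEq]; exact ⟨h1, h2⟩
    -- On band `j` the bound is `b + ε = (j + 2) ε ≤ wt + 2 ε`.
    have hpiece : ∀ j, volume (Φ '' B j) ≤ ∫⁻ X in Γ,
        (Icc ((j : ℝ) * ε) ((j + 1) * ε)).indicator (fun _ => (1 : ℝ≥0∞)) (wt X) *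
        ((ENNReal.ofReal (wt X) + 2 * ENNReal.ofReal ε) * ENNReal.ofReal |(A X).det|) := by
      intro j
      have h1 := H.volume_slope_height_le hm4 (hBc j) (fun X hX => hX.1)
        (b := (j + 1) * ε) (by positivity) hε (fun X hX => hX.2.2) X₁.1
      refine h1.trans ?_
      rw [← lintegral_const_mul' _ _ ENNReal.ofReal_ne_top,
        ← lintegral_indicator (hBc j).measurableSet, ← lintegral_indicator hΓc.measurableSet]
      refine lintegral_mono fun X => ?_
      by_cases hX : X ∈ B j
      · rw [indicator_of_mem hX, indicator_of_mem hX.1, indicator_of_mem hX.2, one_mul]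
        gcongr
        have h0 : 0 ≤ wt X := le_trans (by positivity) hX.2.1
        rw [show (2 : ℝ≥0∞) = ENNReal.ofReal 2 by simp, ← ENNReal.ofReal_mul zero_le_two,
          ← ENNReal.ofReal_add h0 (by positivity)]
        refine ENNReal.ofReal_le_ofReal ?_
        linarith [hX.2.1]
      · rw [indicator_of_notMem hX]; exact zero_le
    have hmeasj : ∀ j : ℕ, AEMeasurable (fun X =>
        (Icc ((j : ℝ) * ε) ((j + 1) * ε)).indicator (fun _ => (1 : ℝ≥0∞)) (wt X) *
        ((ENNReal.ofReal (wt X) + 2 * ENNReal.ofReal ε) * ENNReal.ofReal |(A X).det|))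
        (volume.restrict Γ) := by
      intro j
      have h1 : Measurable ((Icc ((j : ℝ) * ε) ((j + 1) * ε)).indicator
        (fun _ => (1 : ℝ≥0∞))) := measurable_const.indicator measurableSet_Icc
      exact (h1.comp_aemeasurable (hwtΓ.aemeasurable hΓc.measurableSet)).mul
        ((hwtm.add_const _).mul hdetm)
    calc volume (ball (0 : Space n) (m / (4 * d))) * ENNReal.ofReal (m / 2)
        = volume (ball (0 : Space n) (m / (4 * d)) ×ˢ Ico (m / 2) m) := by
          rw [Measure.volume_eq_prod, Measure.prod_prod, Real.volume_Ico]
          congr 2; ring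
      _ ≤ volume (⋃ j ∈ Finset.range N, Φ '' B j) := measure_mono hcover
      _ ≤ ∑ j ∈ Finset.range N, volume (Φ '' B j) := measure_biUnion_finset_le _ _
      _ ≤ ∑ j ∈ Finset.range N, _ := Finset.sum_le_sum fun j _ => hpiece j
      _ = ∫⁻ X in Γ, (∑ j ∈ Finset.range N,
            (Icc ((j : ℝ) * ε) ((j + 1) * ε)).indicator (fun _ => (1 : ℝ≥0∞)) (wt X)) *
            ((ENNReal.ofReal (wt X) + 2 * ENNReal.ofReal ε) * ENNReal.ofReal |(A X).det|) := by
          rw [← lintegral_finsetSum' _ fun j _ => hmeasj j]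
          simp only [Finset.sum_mul]
      _ ≤ ∫⁻ X in Γ, 2 *
            ((ENNReal.ofReal (wt X) + 2 * ENNReal.ofReal ε) * ENNReal.ofReal |(A X).det|) := by
          refine lintegral_mono fun X => ?_
          gcongr
          exact sum_indicator_Icc_le_two hε N (wt X)
      _ = ∫⁻ X in Γ, (2 * (ENNReal.ofReal (wt X) * ENNReal.ofReal |(A X).det|) +
            (4 * ENNReal.ofReal ε) * ENNReal.ofReal |(A X).det|) := by
          refine lintegral_congr fun X => ?_
          ring
      _ = _ := by
          have hmul : AEMeasurable (fun X => 2 * (ENNReal.ofReal (wt X) *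
              ENNReal.ofReal |(A X).det|)) (volume.restrict Γ) := (hwtm.mul hdetm).const_mul _
          rw [lintegral_add_left' hmul, lintegral_const_mul' _ _ (by simp),
            lintegral_const_mul' _ _ (ENNReal.mul_ne_top (by simp) ENNReal.ofReal_ne_top), ← hI]
          ring
  have hlim : Tendsto (fun ε : ℝ =>
      2 * (∫⁻ X in Γ, ENNReal.ofReal (wt X) * ENNReal.ofReal |(A X).det|)
        + ENNReal.ofReal ε * (4 * I)) (𝓝[>] 0)
      (𝓝 (2 * (∫⁻ X in Γ, ENNReal.ofReal (wt X) * ENNReal.ofReal |(A X).det|)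
        + ENNReal.ofReal 0 * (4 * I))) := by
    refine Tendsto.const_add _ (ENNReal.Tendsto.mul_const ?_ (Or.inr ?_))
    · exact (ENNReal.continuous_ofReal.tendsto 0).mono_left nhdsWithin_le_nhds
    · exact ENNReal.mul_ne_top (by simp) hIfin
  simp only [ENNReal.ofReal_zero, zero_mul, add_zero] at hlim
  refine ge_of_tendsto hlim ?_
  filter_upwards [self_mem_nhdsWithin] with ε hε using key ε hε

end ContactData

/-! ### From continuous partial derivatives to gradients and Hessians. -/

section Derivatives

variable {n : ℕ}

theorem hasDerivAt_line {f : Space n → ℝ} {x e : Space n} {f' : ℝ} {c s : ℝ}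
    (h : HasLineDerivAt ℝ f f' (x + s • c • e) e) :
    HasDerivAt (fun t : ℝ => f (x + t • c • e)) (c * f') s := by
  have h1 := h.smul c
  have h2 : HasDerivAt (fun t : ℝ => f (x + s • c • e + t • c • e)) (c • f') (s - s) := by
    rw [sub_self]; exact h1
  have h3 := h2.comp_sub_const (x := s) (a := s)
  refine (h3.congr_of_eventuallyEq (Eventually.of_forall fun t => ?_)).congr_deriv (smul_eq_mul _ _)
  simp only [sub_smul]
  congr 1; abel

/-- A function whose partial derivatives exist and are continuous in an open set is
differentiable there. -/
theorem hasFDerivAt_of_continuousOn_lineDeriv {f : Space n → ℝ} {V : Set (Space n)} (hV : IsOpen V)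
    {D : Space n → Space n} (hD : ContinuousOn D V)
    (hf : ∀ i, ∀ x ∈ V, HasLineDerivAt ℝ f (D x i) x (EuclideanSpace.single i 1))
    {x : Space n} (hx : x ∈ V) : HasFDerivAt f (innerSL ℝ (D x)) x := by
  classical
  rw [hasFDerivAt_iff_isLittleO_nhds_zero, Asymptotics.isLittleO_iff]
  intro c hc
  set ε : ℝ := c / (n + 1) with hε
  have hεpos : 0 < ε := by positivity
  have hev : ∀ᶠ y in 𝓝 x, y ∈ V ∧ dist (D y) (D x) < ε :=
    (hV.eventually_mem hx).and
      ((hD.continuousAt (hV.mem_nhds hx)).tendsto.eventually (ball_mem_nhds _ hεpos))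
  obtain ⟨δ, hδ, hball⟩ := Metric.eventually_nhds_iff.1 hev
  have hcoord : ∀ (y : Space n) i, |y i| ≤ ‖y‖ := fun y i => by
    simpa using PiLp.norm_apply_le y i
  filter_upwards [ball_mem_nhds (0 : Space n) (show 0 < δ / (n + 1) by positivity)] with v hv
  have hv' : ‖v‖ < δ / (n + 1) := by simpa using hv
  have hsumv : ∑ i, |v i| ≤ n * ‖v‖ := by
    calc ∑ i, |v i| ≤ ∑ _i : Fin n, ‖v‖ := Finset.sum_le_sum fun i _ => hcoord v i
      _ = n * ‖v‖ := by simp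
  have hsmall : ∑ i, |v i| < δ := by
    have : (n + 1) * ‖v‖ < δ := by rw [lt_div_iff₀ (by positivity)] at hv'; linarith
    nlinarith [norm_nonneg v]
  let e : Fin n → Space n := fun i => EuclideanSpace.single i 1
  -- Coordinates are changed one at a time; each change is estimated by the mean value inequality
  -- along a coordinate segment.
  have hpart : ∀ s : Finset (Fin n),
      |f (x + ∑ i ∈ s, v i • e i) - f x - ∑ i ∈ s, v i * D x i| ≤ ε * ∑ i ∈ s, |v i| := by
    intro s
    induction s using Finset.induction_on with
    | empty => simp
    | insert j s hj ih =>
      rw [Finset.sum_insert hj, Finset.sum_insert hj, Finset.sum_insert hj]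
      set p := ∑ i ∈ s, v i • e i with hp
      have hpn : ∀ t ∈ Icc (0 : ℝ) 1, dist (x + p + t • v j • e j) x < δ := by
        intro t ht
        have h1 : ‖p‖ ≤ ∑ i ∈ s, |v i| := by
          refine (norm_sum_le _ _).trans (Finset.sum_le_sum fun i _ => ?_)
          simp [e, norm_smul]
        have h2 : ‖t • v j • e j‖ ≤ |v j| := by
          simp only [e, norm_smul, PiLp.norm_single, norm_one, mul_one, Real.norm_eq_abs]
          rw [abs_of_nonneg ht.1]
          exact mul_le_of_le_one_left (abs_nonneg _) ht.2
        have h3 : ∑ i ∈ s, |v i| + |v j| ≤ ∑ i, |v i| := by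
          rw [add_comm, ← Finset.sum_insert (f := fun i => |v i|) hj]
          exact Finset.sum_le_univ_sum_of_nonneg fun i => abs_nonneg _
        rw [dist_eq_norm, show x + p + t • v j • e j - x = p + t • v j • e j by abel]
        linarith [norm_add_le p (t • v j • e j)]
      have hmv := norm_image_sub_le_of_norm_deriv_le_segment_01'
        (f := fun t : ℝ => f (x + p + t • v j • e j) - t * (v j * D x j))
        (f' := fun t => v j * D (x + p + t • v j • e j) j - v j * D x j) (C := ε * |v j|)
        (fun t ht => by
          have h1 := hasDerivAt_line (c := v j) (hf j _ (hball (hpn t ht)).1)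
          have h2 := (hasDerivAt_id t).mul_const (v j * D x j)
          rw [one_mul] at h2
          exact (h1.sub h2).hasDerivWithinAt)
        (fun t ht => by
          have h1 := (hball (hpn t ⟨ht.1, ht.2.le⟩)).2
          rw [dist_eq_norm] at h1
          have h2 := hcoord (D (x + p + t • v j • e j) - D x) j
          rw [← mul_sub, norm_mul, mul_comm]
          refine mul_le_mul_of_nonneg_right ?_ (norm_nonneg _)
          simpa using h2.trans h1.le)
      simp only [one_smul, zero_smul, add_zero, one_mul, zero_mul, sub_zero] at hmv
      rw [Real.norm_eq_abs] at hmv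
      have e1 : f (x + (v j • e j + p)) - f x - (v j * D x j + ∑ i ∈ s, v i * D x i) =
          (f (x + p + v j • e j) - v j * D x j - f (x + p)) +
            (f (x + p) - f x - ∑ i ∈ s, v i * D x i) := by
        rw [show x + (v j • e j + p) = x + p + v j • e j by abel]; ring
      rw [e1, mul_add]
      exact (abs_add_le _ _).trans (add_le_add hmv ih)
  have hfull := hpart Finset.univ
  have hvsum : ∑ i, v i • e i = v := by
    simpa [e] using (EuclideanSpace.basisFun (Fin n) ℝ).sum_repr v
  rw [hvsum] at hfull
  have hin : (innerSL ℝ (D x)) v = ∑ i, v i * D x i := by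
    rw [innerSL_apply_apply, PiLp.inner_apply]
    exact Finset.sum_congr rfl fun i _ => by simp
  rw [hin, Real.norm_eq_abs]
  refine hfull.trans ?_
  calc ε * ∑ i, |v i| ≤ ε * (n * ‖v‖) := by gcongr
    _ ≤ ε * ((n + 1) * ‖v‖) := by gcongr; linarith
    _ = c * ‖v‖ := by rw [hε]; field_simp

/-- The spatial gradient of `u`. -/
noncomputable def gradX (u : SpaceTime n → ℝ) (X : SpaceTime n) : Space n :=
  WithLp.toLp 2 fun i => dx i u X

/-- The spatial Hessian of `u`. -/
noncomputable def hessX (u : SpaceTime n → ℝ) (X : SpaceTime n) : Space n →L[ℝ] Space n :=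
  ∑ i, (innerSL ℝ (gradX (dx i u) X)).smulRight (EuclideanSpace.single i 1)

theorem hessX_single_apply (u : SpaceTime n → ℝ) (X : SpaceTime n) (i j : Fin n) :
    hessX u X (EuclideanSpace.single i 1) j = dx i (dx j u) X := by
  simp [hessX, gradX, Finset.sum_apply, Pi.single_apply, EuclideanSpace.inner_single_right]

theorem continuousOn_gradX {u : SpaceTime n → ℝ} {Ω : Set (SpaceTime n)}
    (h : ∀ i, ContinuousOn (dx i u) Ω) : ContinuousOn (gradX u) Ω :=
  (PiLp.continuous_toLp 2 _).comp_continuousOn (continuousOn_pi.2 h)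

theorem hasFDerivAt_gradX {u : SpaceTime n → ℝ} {Ω : Set (SpaceTime n)} (hΩ : IsOpen Ω)
    (h₁ : ∀ i, ∀ X ∈ Ω, HasDx i u X) (h₂ : ∀ i, ContinuousOn (dx i u) Ω) {X : SpaceTime n}
    (hX : X ∈ Ω) : HasFDerivAt (fun x => u (x, X.2)) (innerSL ℝ (gradX u X)) X.1 := by
  have hc : Continuous fun x : Space n => (x, X.2) := by fun_prop
  exact hasFDerivAt_of_continuousOn_lineDeriv (V := {x | (x, X.2) ∈ Ω}) (hΩ.preimage hc)
    (D := fun x => gradX u (x, X.2))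
    ((continuousOn_gradX h₂).comp hc.continuousOn fun x hx => hx)
    (fun i x hx => (h₁ i (x, X.2) hx).hasLineDerivAt) hX

theorem IsC21On.hasC21Derivs {u : SpaceTime n → ℝ} {Ω : Set (SpaceTime n)} (hΩ : IsOpen Ω)
    (hu : IsC21On u Ω) : HasC21Derivs Ω u (dt u) (gradX u) (hessX u) where
  cont_time := hu.dt_cont
  cont_grad := continuousOn_gradX hu.dx_cont
  cont_hess := by
    refine continuousOn_finsetSum _ fun i _ => ?_
    have h1 : ContinuousOn (fun X => innerSL ℝ (gradX (dx i u) X)) Ω :=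
      (innerSL ℝ).continuous.comp_continuousOn (continuousOn_gradX fun j => hu.dxx_cont j i)
    have h2 : Continuous fun L : Space n →L[ℝ] ℝ =>
        L.smulRight (EuclideanSpace.single i (1 : ℝ) : Space n) :=
      ((ContinuousLinearMap.smulRightL ℝ (Space n) (Space n)).flip
        (EuclideanSpace.single i (1 : ℝ))).continuous
    exact h2.comp_continuousOn h1
  hasDerivAt X hX := (hu.dt_exists X hX).hasDerivAt
  hasGrad X hX := hasFDerivAt_gradX hΩ hu.dx_exists hu.dx_cont hX
  hasHess X hX := by
    have h1 : ∀ i, HasFDerivAt (fun x => dx i u (x, X.2)) (innerSL ℝ (gradX (dx i u) X)) X.1 :=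
      fun i => hasFDerivAt_gradX hΩ (fun j => hu.dxx_exists j i) (fun j => hu.dxx_cont j i) hX
    have h2 : (fun x => gradX u (x, X.2)) = fun x =>
        ∑ i, dx i u (x, X.2) • (EuclideanSpace.single i (1 : ℝ) : Space n) := by
      funext x
      simpa [gradX] using ((EuclideanSpace.basisFun (Fin n) ℝ).sum_repr (gradX u (x, X.2))).symm
    rw [h2]
    exact HasFDerivAt.fun_sum fun i _ => (h1 i).smul_const _

theorem HasC21Derivs.mono {U V : Set (SpaceTime n)} {w wt : SpaceTime n → ℝ}
    {Dw : SpaceTime n → Space n} {A : SpaceTime n → Space n →L[ℝ] Space n}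
    (h : HasC21Derivs U w wt Dw A) (hVU : V ⊆ U) : HasC21Derivs V w wt Dw A where
  cont_time := h.cont_time.mono hVU
  cont_grad := h.cont_grad.mono hVU
  cont_hess := h.cont_hess.mono hVU
  hasDerivAt X hX := h.hasDerivAt X (hVU hX)
  hasGrad X hX := h.hasGrad X (hVU hX)
  hasHess X hX := h.hasHess X (hVU hX)

theorem HasC21Derivs.add_const_smul {U : Set (SpaceTime n)} {u ut v vt : SpaceTime n → ℝ}
    {Du Dv : SpaceTime n → Space n} {A B : SpaceTime n → Space n →L[ℝ] Space n}
    (hu : HasC21Derivs U u ut Du A) (hv : HasC21Derivs U v vt Dv B) (a b : ℝ) :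
    HasC21Derivs U (fun X => u X + a * v X + b) (fun X => ut X + a * vt X)
      (fun X => Du X + a • Dv X) (fun X => A X + a • B X) where
  cont_time := hu.cont_time.add (hv.cont_time.const_smul a)
  cont_grad := hu.cont_grad.add (hv.cont_grad.const_smul a)
  cont_hess := hu.cont_hess.add (hv.cont_hess.const_smul a)
  hasDerivAt X hX := ((hu.hasDerivAt X hX).add ((hv.hasDerivAt X hX).const_mul a)).add_const b
  hasGrad X hX := by
    have := ((hu.hasGrad X hX).add ((hv.hasGrad X hX).const_mul a)).add_const b
    simpa using! this
  hasHess X hX := (hu.hasHess X hX).add ((hv.hasHess X hX).const_smul a)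

theorem HasC21Derivs.hess_symm {U : Set (SpaceTime n)} (hU : IsOpen U) {w wt : SpaceTime n → ℝ}
    {Dw : SpaceTime n → Space n} {A : SpaceTime n → Space n →L[ℝ] Space n}
    (h : HasC21Derivs U w wt Dw A) {X : SpaceTime n} (hX : X ∈ U) (η ζ : Space n) :
    inner ℝ (A X η) ζ = inner ℝ (A X ζ) η := by
  have hc : Continuous fun x : Space n => (x, X.2) := by fun_prop
  have h1 : ∀ᶠ x in 𝓝 X.1, HasFDerivAt (fun x => w (x, X.2)) (innerSL ℝ (Dw (x, X.2))) x := by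
    filter_upwards [hc.continuousAt.eventually_mem (hU.mem_nhds hX)] with x hx
    exact h.hasGrad _ hx
  have h2 : HasFDerivAt (fun x => innerSL ℝ (Dw (x, X.2))) ((innerSL ℝ).comp (A X)) X.1 :=
    (innerSL ℝ).hasFDerivAt.comp X.1 (h.hasHess X hX)
  exact second_derivative_symmetric_of_eventually_of_real h1 h2 η ζ

end Derivatives

/-! ### The barrier in a slanted cylinder -/

section Barrier

variable {n : ℕ} (z b : Space n) (τ Θ R lam : ℝ)

/-- The position relative to the axis of the slanted cylinder. -/
noncomputable def slantPos (X : SpaceTime n) : Space n := X.1 - (z + ((X.2 - τ) / Θ) • b)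

/-- The parabolic profile `1 - |ξ|² / R²`. -/
noncomputable def slantProfile (X : SpaceTime n) : ℝ := 1 - ‖slantPos z b τ Θ X‖ ^ 2 / R ^ 2

/-- The exponential damping factor. -/
noncomputable def slantDamping (X : SpaceTime n) : ℝ := Real.exp (-(lam / Θ) * (X.2 - τ))

/-- The barrier `exp (-λ (t - τ) / Θ) (1 - |ξ|² / R²)²`. -/
noncomputable def barrier (X : SpaceTime n) : ℝ :=
  slantDamping τ Θ lam X * slantProfile z b τ Θ R X ^ 2

/-- The time derivative of the barrier. -/
noncomputable def barrierT (X : SpaceTime n) : ℝ :=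
  slantDamping τ Θ lam X * (-(lam / Θ) * slantProfile z b τ Θ R X ^ 2 +
    4 / (Θ * R ^ 2) * slantProfile z b τ Θ R X * inner ℝ (slantPos z b τ Θ X) b)

/-- The spatial gradient of the barrier. -/
noncomputable def barrierGrad (X : SpaceTime n) : Space n :=
  (slantDamping τ Θ lam X * (-4 / R ^ 2 * slantProfile z b τ Θ R X)) • slantPos z b τ Θ X

/-- The spatial Hessian of the barrier. -/
noncomputable def barrierHess (X : SpaceTime n) : Space n →L[ℝ] Space n :=
  slantDamping τ Θ lam X • ((8 / R ^ 4) • ((innerSL ℝ (slantPos z b τ Θ X)).smulRight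
    (slantPos z b τ Θ X)) - (4 / R ^ 2 * slantProfile z b τ Θ R X) • ContinuousLinearMap.id ℝ _)

theorem continuous_slantPos : Continuous (slantPos z b τ Θ) := by
  unfold slantPos; fun_prop

theorem continuous_slantProfile : Continuous (slantProfile z b τ Θ R) := by
  have := continuous_slantPos z b τ Θ
  unfold slantProfile; fun_prop

theorem continuous_slantDamping : Continuous (slantDamping (n := n) τ Θ lam) := by
  unfold slantDamping; fun_prop

theorem continuous_barrier : Continuous (barrier z b τ Θ R lam) :=
  (continuous_slantDamping τ Θ lam).mul ((continuous_slantProfile z b τ Θ R).pow 2)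

theorem continuous_smul_smulRight_sub_smul_id {X E : Type*} [TopologicalSpace X]
    [NormedAddCommGroup E] [InnerProductSpace ℝ E] {p : X → E} {f g : X → ℝ} (hp : Continuous p)
    (hf : Continuous f) (hg : Continuous g) (c : ℝ) :
    Continuous fun x => f x • (c • ((innerSL ℝ (p x)).smulRight (p x)) -
      g x • ContinuousLinearMap.id ℝ E) := by
  fun_prop

theorem continuous_barrierHess : Continuous (barrierHess z b τ Θ R lam) :=
  continuous_smul_smulRight_sub_smul_id (continuous_slantPos z b τ Θ)
    (continuous_slantDamping τ Θ lam)
    (continuous_const.mul (continuous_slantProfile z b τ Θ R)) (8 / R ^ 4)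

theorem hasFDerivAt_slantPos (X : SpaceTime n) : HasFDerivAt (fun x => slantPos z b τ Θ (x, X.2))
    (ContinuousLinearMap.id ℝ (Space n)) X.1 :=
  (hasFDerivAt_id X.1).sub_const (z + ((X.2 - τ) / Θ) • b)

theorem hasFDerivAt_slantProfile (X : SpaceTime n) :
    HasFDerivAt (fun x => slantProfile z b τ Θ R (x, X.2))
      ((-2 / R ^ 2) • innerSL ℝ (slantPos z b τ Θ X)) X.1 := by
  have h := ((hasFDerivAt_slantPos z b τ Θ X).norm_sq.mul_const (1 / R ^ 2)).const_sub 1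
  refine (h.congr_of_eventuallyEq (Eventually.of_forall fun x => ?_)).congr_fderiv ?_
  · simp [slantProfile, div_eq_mul_inv]
  · ext y
    simp
    ring

theorem hasDerivAt_slantPos (X : SpaceTime n) :
    HasDerivAt (fun t => slantPos z b τ Θ (X.1, t)) (-((1 / Θ) • b)) X.2 := by
  have h1 : HasDerivAt (fun t : ℝ => (t - τ) / Θ) (1 / Θ) X.2 :=
    ((hasDerivAt_id X.2).sub_const τ).div_const Θ
  have h2 : HasDerivAt (fun t : ℝ => ((t - τ) / Θ) • b) ((1 / Θ) • b) X.2 := h1.smul_const b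
  exact (h2.const_add z).const_sub X.1

theorem hasDerivAt_slantProfile (X : SpaceTime n) :
    HasDerivAt (fun t => slantProfile z b τ Θ R (X.1, t))
      (2 / (Θ * R ^ 2) * inner ℝ (slantPos z b τ Θ X) b) X.2 := by
  have h := ((hasDerivAt_slantPos z b τ Θ X).norm_sq.div_const (R ^ 2)).const_sub 1
  refine h.congr_deriv ?_
  rw [inner_neg_right, inner_smul_right]
  ring

theorem hasDerivAt_slantDamping (X : SpaceTime n) :
    HasDerivAt (fun t => slantDamping τ Θ lam (X.1, t))
      (slantDamping τ Θ lam X * -(lam / Θ)) X.2 := by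
  have h1 : HasDerivAt (fun t : ℝ => -(lam / Θ) * (t - τ)) (-(lam / Θ) * 1) X.2 :=
    ((hasDerivAt_id X.2).sub_const τ).const_mul (-(lam / Θ))
  rw [mul_one] at h1
  exact h1.exp

theorem hasC21Derivs_barrier : HasC21Derivs univ (barrier z b τ Θ R lam)
    (barrierT z b τ Θ R lam) (barrierGrad z b τ Θ R lam) (barrierHess z b τ Θ R lam) := by
  have hpos := continuous_slantPos z b τ Θ
  have hprof := continuous_slantProfile z b τ Θ R
  have hdamp := continuous_slantDamping (n := n) τ Θ lam
  refine ⟨?_, ?_, ?_, fun X _ => ?_, fun X _ => ?_, fun X _ => ?_⟩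
  · refine Continuous.continuousOn ?_
    unfold barrierT; fun_prop
  · refine Continuous.continuousOn ?_
    unfold barrierGrad; fun_prop
  · exact (continuous_barrierHess z b τ Θ R lam).continuousOn
  · refine ((hasDerivAt_slantDamping τ Θ lam X).mul
      ((hasDerivAt_slantProfile z b τ Θ R X).pow 2)).congr_deriv ?_
    simp only [barrierT, Pi.pow_apply]
    push_cast
    ring
  · have h := ((hasFDerivAt_slantProfile z b τ Θ R X).pow 2).const_mul (slantDamping τ Θ lam X)
    refine h.congr_fderiv ?_
    ext y
    simp [barrierGrad]
    ring
  · have h1 : HasFDerivAt (fun x => (slantDamping τ Θ lam X *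
        (-4 / R ^ 2 * slantProfile z b τ Θ R (x, X.2))) • slantPos z b τ Θ (x, X.2)) _ X.1 :=
      (((hasFDerivAt_slantProfile z b τ Θ R X).const_mul (-4 / R ^ 2)).const_mul
        (slantDamping τ Θ lam X)).smul (hasFDerivAt_slantPos z b τ Θ X)
    refine HasFDerivAt.congr_fderiv h1 ?_
    ext1 y
    simp only [barrierHess, _root_.add_apply, _root_.smul_apply, _root_.sub_apply,
      ContinuousLinearMap.id_apply, ContinuousLinearMap.smulRight_apply,
      innerSL_apply_apply, smul_eq_mul]
    module

end Barrier

/-! ### Trace and determinant inequalities for semidefinite matrices. -/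

section LinearAlgebra

variable {n : ℕ}

/-- A positive semidefinite `M` is a sum of rank-one matrices `v vᵀ`, and for each of these the
claim is ellipticity at `v`. -/
theorem mul_trace_le_sum_mul {ν : ℝ} {a M : Matrix (Fin n) (Fin n) ℝ} (hM : M.PosSemidef)
    (ha : ∀ ξ : Space n, ν * ‖ξ‖ ^ 2 ≤ ∑ i, ∑ j, a i j * ξ i * ξ j) :
    ν * M.trace ≤ ∑ i, ∑ j, a i j * M i j := by
  obtain ⟨k, v, rfl⟩ := Matrix.posSemidef_iff_eq_sum_vecMulVec.1 hM
  have h1 : ∀ l, ν * ∑ i, v l i * v l i ≤ ∑ i, ∑ j, a i j * v l i * v l j := by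
    intro l
    have h := ha (WithLp.toLp 2 (v l))
    rw [EuclideanSpace.real_norm_sq_eq] at h
    simpa [pow_two] using h
  have h2 := Finset.sum_le_sum (s := Finset.univ) fun l _ => h1 l
  have e1 : (∑ l, Matrix.vecMulVec (v l) (star (v l))).trace = ∑ l, ∑ i, v l i * v l i := by
    rw [Finset.sum_comm]
    simp [Matrix.trace, Matrix.sum_apply, Matrix.vecMulVec_apply]
  have e2 : ∑ i, ∑ j, a i j * (∑ l, Matrix.vecMulVec (v l) (star (v l))) i j =
      ∑ l, ∑ i, ∑ j, a i j * v l i * v l j := by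
    rw [Finset.sum_comm]
    simp only [Matrix.sum_apply, Matrix.vecMulVec_apply, star_trivial,
      Finset.mul_sum]
    rw [Finset.sum_comm]
    rw [Finset.sum_congr rfl fun i _ => Finset.sum_comm]
    rw [Finset.sum_comm]
    refine Finset.sum_congr rfl fun i _ => Finset.sum_congr rfl fun j _ =>
      Finset.sum_congr rfl fun l _ => by ring
  rw [e1, e2, Finset.mul_sum]
  exact h2

/-- For each rank-one summand, `|v_i v_j| ≤ (v_i² + v_j²) / 2 ≤ |v|²`. -/
theorem abs_apply_le_trace {M : Matrix (Fin n) (Fin n) ℝ} (hM : M.PosSemidef) (i j : Fin n) :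
    |M i j| ≤ M.trace := by
  obtain ⟨k, v, rfl⟩ := Matrix.posSemidef_iff_eq_sum_vecMulVec.1 hM
  have e1 : (∑ l, Matrix.vecMulVec (v l) (star (v l))).trace = ∑ l, ∑ i, v l i * v l i := by
    rw [Finset.sum_comm]
    simp [Matrix.trace, Matrix.sum_apply, Matrix.vecMulVec_apply]
  rw [e1]
  simp only [Matrix.sum_apply, Matrix.vecMulVec_apply, star_trivial]
  refine (Finset.abs_sum_le_sum_abs _ _).trans (Finset.sum_le_sum fun l _ => ?_)
  have hs : ∀ i, v l i * v l i ≤ ∑ i, v l i * v l i := fun i =>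
    Finset.single_le_sum (f := fun i => v l i * v l i) (fun i _ => mul_self_nonneg _)
      (Finset.mem_univ i)
  rw [abs_le]
  constructor <;> nlinarith [hs i, hs j, sq_nonneg (v l i + v l j), sq_nonneg (v l i - v l j)]

/-- Each of the `n!` Leibniz terms is at most the `n`-th power of the entry bound. -/
theorem abs_det_le_trace_pow {M : Matrix (Fin n) (Fin n) ℝ} (hM : M.PosSemidef) :
    |M.det| ≤ n.factorial * M.trace ^ n := by
  have := Matrix.det_le (abv := AbsoluteValue.abs) (A := M) fun i j => abs_apply_le_trace hM i j
  simpa using this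

/-- The arithmetic-geometric inequality behind the maximum principle, with a crude constant. -/
theorem mul_abs_det_le {ν om wt f : ℝ} (hν : 0 < ν) (hom : 0 < om) (hwt : 0 ≤ wt)
    {a : Matrix (Fin n) (Fin n) ℝ}
    (ha : ∀ ξ : Space n, ν * ‖ξ‖ ^ 2 ≤ ∑ i, ∑ j, a i j * ξ i * ξ j)
    {A : Space n →L[ℝ] Space n} (hsymm : ∀ η ζ, inner ℝ (A η) ζ = inner ℝ (A ζ) η)
    (hneg : ∀ η, inner ℝ (A η) η ≤ 0)
    (hf : wt - om * ∑ i, ∑ j, a i j * A (EuclideanSpace.single i 1) j ≤ f) :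
    wt * |A.det| ≤ n.factorial * f ^ (n + 1) / (ν * om) ^ n := by
  let b := (EuclideanSpace.basisFun (Fin n) ℝ).toBasis
  set M : Matrix (Fin n) (Fin n) ℝ := LinearMap.toMatrix b b (A : Space n →ₗ[ℝ] Space n) with hMdef
  have hMij : ∀ i j, M i j = A (EuclideanSpace.single j 1) i := by
    intro i j
    simp [hMdef, b, LinearMap.toMatrix_apply]
  have hsym : ∀ i j, M i j = M j i := by
    intro i j
    have := hsymm (EuclideanSpace.single j 1) (EuclideanSpace.single i 1)
    simpa [hMij, EuclideanSpace.inner_single_right] using this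
  have hdet : A.det = M.det := (LinearMap.det_toMatrix b _).symm
  have hpsd : (-M).PosSemidef := by
    refine Matrix.PosSemidef.of_dotProduct_mulVec_nonneg ?_ fun x => ?_
    · ext i j; simp [hsym i j]
    · have h1 := hneg (WithLp.toLp 2 x)
      have h2 : ∀ i, A (WithLp.toLp 2 x) i = (M.mulVec x) i := by
        intro i
        have h3 := congrFun (LinearMap.toMatrix_mulVec_repr b b
          (A : Space n →ₗ[ℝ] Space n) (WithLp.toLp 2 x)) i
        have h5 : ⇑(b.repr (WithLp.toLp 2 x)) = x := by ext j; simp [b]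
        rw [h5] at h3
        simpa [b] using h3.symm
      have h4 : inner ℝ (A (WithLp.toLp 2 x)) (WithLp.toLp 2 x) = x ⬝ᵥ M.mulVec x := by
        rw [PiLp.inner_apply, dotProduct]
        exact Finset.sum_congr rfl fun i _ => by simp [h2]
      rw [h4] at h1
      simpa [Matrix.neg_mulVec] using h1
  have htr : 0 ≤ (-M).trace := hpsd.trace_nonneg
  have h1 := mul_trace_le_sum_mul hpsd ha
  have h2 : ∑ i, ∑ j, a i j * (-M) i j =
      - ∑ i, ∑ j, a i j * A (EuclideanSpace.single i 1) j := by
    simp only [Matrix.neg_apply, mul_neg, Finset.sum_neg_distrib]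
    congr 1
    exact Finset.sum_congr rfl fun i _ => Finset.sum_congr rfl fun j _ => by
      rw [hsym i j, hMij]
  rw [h2] at h1
  -- Both terms on the left are non-negative, so `f` bounds each separately: one controls `wt`, the
  -- other the trace and hence the determinant.
  have h3 : om * (ν * (-M).trace) + wt ≤ f := by nlinarith
  have hf0 : 0 ≤ f := le_trans (by positivity) h3
  have hwf : wt ≤ f := le_trans (by nlinarith [mul_nonneg hom.le (mul_nonneg hν.le htr)]) h3
  have htf : (-M).trace ≤ f / (ν * om) := by
    rw [le_div_iff₀ (by positivity)]; nlinarith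
  have h4 : |A.det| ≤ n.factorial * (f / (ν * om)) ^ n := by
    have h5 := abs_det_le_trace_pow hpsd
    rw [Matrix.det_neg, abs_mul, abs_pow, abs_neg, abs_one, one_pow, one_mul] at h5
    rw [hdet]
    refine h5.trans ?_
    gcongr
  calc wt * |A.det| ≤ f * (n.factorial * (f / (ν * om)) ^ n) := by gcongr
    _ = _ := by rw [div_pow, pow_succ]; ring

end LinearAlgebra

/-! ### The barrier as a subsolution of the frozen operator. -/

section BarrierEstimates

variable {n : ℕ} {z b : Space n} {τ Θ R lam : ℝ}

theorem barrierHess_single_apply (X : SpaceTime n) (i j : Fin n) :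
    barrierHess z b τ Θ R lam X (EuclideanSpace.single i 1) j = slantDamping τ Θ lam X *
      (8 / R ^ 4 * (slantPos z b τ Θ X i * slantPos z b τ Θ X j) -
        4 / R ^ 2 * slantProfile z b τ Θ R X * (if i = j then 1 else 0)) := by
  simp [barrierHess, EuclideanSpace.inner_single_right, eq_comm]

theorem sum_mul_barrierHess (a : Matrix (Fin n) (Fin n) ℝ) (X : SpaceTime n) :
    ∑ i, ∑ j, a i j * barrierHess z b τ Θ R lam X (EuclideanSpace.single i 1) j =
      slantDamping τ Θ lam X * (8 / R ^ 4 *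
        (∑ i, ∑ j, a i j * slantPos z b τ Θ X i * slantPos z b τ Θ X j) -
        4 / R ^ 2 * slantProfile z b τ Θ R X * ∑ i, a i i) := by
  simp only [barrierHess_single_apply]
  rw [mul_sub, Finset.mul_sum, Finset.mul_sum, Finset.mul_sum, Finset.mul_sum,
    ← Finset.sum_sub_distrib]
  refine Finset.sum_congr rfl fun i _ => ?_
  have e : slantDamping τ Θ lam X * (4 / R ^ 2 * slantProfile z b τ Θ R X * a i i) =
      ∑ j, slantDamping τ Θ lam X * (4 / R ^ 2 * slantProfile z b τ Θ R X *
        (a i j * if i = j then 1 else 0)) := by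
    simp
  rw [e, Finset.mul_sum, Finset.mul_sum, ← Finset.sum_sub_distrib]
  exact Finset.sum_congr rfl fun j _ => by ring

/-- The left side is at most `-lam g² + B g - 8νN₀` with `B = 16q + N₁(8ν + 4ν')`; `hlam` says that
this quadratic has non-positive discriminant. -/
theorem barrier_polynomial_le {g ν q ν' N N₀ N₁ lam x y : ℝ} (hg : 0 ≤ g) (hν : 0 < ν)
    (hν' : 0 ≤ ν') (hN₀ : 0 < N₀) (hNN₀ : N₀ ≤ N) (hNN₁ : N ≤ N₁)
    (hlam : (16 * q + N₁ * (8 * ν + 4 * ν')) ^ 2 ≤ lam * (32 * ν * N₀))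
    (hx : x ≤ 16 * q * g) (hy : 8 * ν * (1 - g) - 4 * g * ν' ≤ y) :
    -lam * g ^ 2 + x - N * y ≤ 0 := by
  have hNpos : 0 < N := hN₀.trans_le hNN₀
  have h4 : N * (8 * ν * (1 - g) - 4 * g * ν') ≤ N * y := by gcongr
  have h5 : N * (8 * ν + 4 * ν') * g ≤ N₁ * (8 * ν + 4 * ν') * g := by gcongr
  have h6 : 8 * ν * N₀ ≤ 8 * ν * N := by gcongr
  obtain ⟨B, hB⟩ : ∃ B, B = 16 * q + N₁ * (8 * ν + 4 * ν') := ⟨_, rfl⟩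
  rw [← hB] at hlam
  have hlam0 : 0 ≤ lam := by
    by_contra! h
    have : lam * (32 * ν * N₀) < 0 := mul_neg_of_neg_of_pos h (by positivity)
    nlinarith [sq_nonneg B]
  have hBg : B * g ≤ lam * g ^ 2 + 8 * ν * N₀ := by
    refine le_of_sq_le_sq ?_ (by positivity)
    have : (B * g) ^ 2 ≤ lam * (32 * ν * N₀) * g ^ 2 := by
      rw [mul_pow]; gcongr
    nlinarith [sq_nonneg (lam * g ^ 2 - 8 * ν * N₀)]
  have e4 : N * (8 * ν * (1 - g) - 4 * g * ν') = 8 * ν * N - N * (8 * ν + 4 * ν') * g := by ring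
  have e5 : B * g = 16 * q * g + N₁ * (8 * ν + 4 * ν') * g := by rw [hB]; ring
  linarith

/-- After division by `slantDamping / Θ` only the profile `g` and the dimensionless duration `N =
cΘ/R²` matter. Near the lateral side (`g` small) the rank-one Hessian term, coming from the square
of the profile, gives the sign; elsewhere the damping does. -/
theorem barrier_subsolution {c ν q N₀ N₁ : ℝ} (hΘ : 0 < Θ) (hR : 0 < R) (hν : 0 < ν)
    (hb : ‖b‖ ≤ 4 * q * R) (hN₀ : 0 < N₀) (hN₀c : N₀ * R ^ 2 ≤ c * Θ)
    (hN₁c : c * Θ ≤ N₁ * R ^ 2)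
    (hlam : (16 * q + N₁ * (8 * ν + 4 * n / ν)) ^ 2 ≤ lam * (32 * ν * N₀))
    {a : Matrix (Fin n) (Fin n) ℝ}
    (ha : ∀ ξ : Space n, ν * ‖ξ‖ ^ 2 ≤ ∑ i, ∑ j, a i j * ξ i * ξ j)
    (hab : ∀ i j, |a i j| ≤ ν⁻¹) {X : SpaceTime n} (hX : ‖slantPos z b τ Θ X‖ ≤ R) :
    barrierT z b τ Θ R lam X -
      c * ∑ i, ∑ j, a i j * barrierHess z b τ Θ R lam X (EuclideanSpace.single i 1) j ≤ 0 := by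
  rw [sum_mul_barrierHess, barrierT]
  set ξ := slantPos z b τ Θ X with hξ
  set e := slantDamping τ Θ lam X with he
  set S := ∑ i, ∑ j, a i j * ξ i * ξ j with hS
  set t := ∑ i, a i i with ht
  have he0 : 0 < e := Real.exp_pos _
  have hR2 : (0 : ℝ) < R ^ 2 := by positivity
  obtain ⟨g, hg⟩ : ∃ g, g = slantProfile z b τ Θ R X := ⟨_, rfl⟩
  rw [← hg]
  have hξg : ‖ξ‖ ^ 2 = R ^ 2 * (1 - g) := by
    rw [hg, slantProfile, ← hξ]; field_simp; ring
  have hξR : ‖ξ‖ ^ 2 ≤ R ^ 2 := by gcongr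
  have hg0 : 0 ≤ g := by
    by_contra! h
    nlinarith
  have hS1 : ν * (R ^ 2 * (1 - g)) ≤ S := by rw [← hξg]; exact ha ξ
  have ht1 : t ≤ n / ν := by
    calc t ≤ ∑ _i : Fin n, ν⁻¹ := Finset.sum_le_sum fun i _ => (le_abs_self _).trans (hab i i)
      _ = n / ν := by simp [div_eq_mul_inv]
  have hin : inner ℝ ξ b ≤ R * (4 * q * R) :=
    (real_inner_le_norm _ _).trans (mul_le_mul hX hb (norm_nonneg _) hR.le)
  have hfac : e * (-(lam / Θ) * g ^ 2 + 4 / (Θ * R ^ 2) * g * inner ℝ ξ b) -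
      c * (e * (8 / R ^ 4 * S - 4 / R ^ 2 * g * t)) =
      e / Θ * (-lam * g ^ 2 + 4 / R ^ 2 * g * inner ℝ ξ b -
        c * Θ / R ^ 2 * (8 / R ^ 2 * S - 4 * g * t)) := by
    field_simp
  rw [hfac]
  refine mul_nonpos_of_nonneg_of_nonpos (by positivity) ?_
  obtain ⟨N, hN⟩ : ∃ N, N = c * Θ / R ^ 2 := ⟨_, rfl⟩
  rw [← hN]
  have hNN₀ : N₀ ≤ N := by rw [hN, le_div_iff₀ hR2]; exact hN₀c
  have hNN₁ : N ≤ N₁ := by rw [hN, div_le_iff₀ hR2]; exact hN₁c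
  have h1 : 4 / R ^ 2 * g * inner ℝ ξ b ≤ 16 * q * g := by
    calc 4 / R ^ 2 * g * inner ℝ ξ b ≤ 4 / R ^ 2 * g * (R * (4 * q * R)) := by gcongr
      _ = 16 * q * g := by field_simp; ring
  have h2 : 8 * ν * (1 - g) ≤ 8 / R ^ 2 * S := by
    calc 8 * ν * (1 - g) = 8 / R ^ 2 * (ν * (R ^ 2 * (1 - g))) := by field_simp
      _ ≤ _ := by gcongr
  have h3 : 4 * g * t ≤ 4 * g * (n / ν) := by gcongr
  exact barrier_polynomial_le (ν' := n / ν) hg0 hν (by positivity) hN₀ hNN₀ hNN₁ (by rwa [← mul_div_assoc]) h1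
    (by linarith)

theorem slantDamping_le_one (hΘ : 0 < Θ) (hlam : 0 ≤ lam) {X : SpaceTime n} (hX : τ ≤ X.2) :
    slantDamping τ Θ lam X ≤ 1 := by
  refine Real.exp_le_one_iff.2 ?_
  have : 0 ≤ lam / Θ * (X.2 - τ) := mul_nonneg (by positivity) (by linarith)
  linarith

theorem slantProfile_mem_Icc (hR : 0 < R) {X : SpaceTime n} (hX : ‖slantPos z b τ Θ X‖ ≤ R) :
    slantProfile z b τ Θ R X ∈ Icc (0 : ℝ) 1 := by
  have h1 : ‖slantPos z b τ Θ X‖ ^ 2 / R ^ 2 ≤ 1 := by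
    rw [div_le_one (by positivity)]; gcongr
  have h2 : 0 ≤ ‖slantPos z b τ Θ X‖ ^ 2 / R ^ 2 := by positivity
  constructor <;> rw [slantProfile] <;> linarith

theorem barrier_mem_Icc (hΘ : 0 < Θ) (hR : 0 < R) (hlam : 0 ≤ lam) {X : SpaceTime n}
    (hXτ : τ ≤ X.2) (hX : ‖slantPos z b τ Θ X‖ ≤ R) : barrier z b τ Θ R lam X ∈ Icc (0 : ℝ) 1 := by
  obtain ⟨h1, h2⟩ := slantProfile_mem_Icc hR hX
  have h3 := slantDamping_le_one hΘ hlam hXτ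
  have h4 : 0 < slantDamping τ Θ lam X := Real.exp_pos _
  exact ⟨by unfold barrier; positivity,
    mul_le_one₀ h3 (by positivity) (pow_le_one₀ h1 h2)⟩

/-- Controls the error made by replacing `ω` with its mean in the equation of the barrier. -/
theorem abs_sum_mul_barrierHess_le {ν : ℝ} (hν : 0 < ν) (hΘ : 0 < Θ) (hR : 0 < R) (hlam : 0 ≤ lam)
    {a : Matrix (Fin n) (Fin n) ℝ} (hab : ∀ i j, |a i j| ≤ ν⁻¹) {X : SpaceTime n} (hXτ : τ ≤ X.2)
    (hX : ‖slantPos z b τ Θ X‖ ≤ R) :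
    |∑ i, ∑ j, a i j * barrierHess z b τ Θ R lam X (EuclideanSpace.single i 1) j| ≤
      12 * n ^ 2 / (ν * R ^ 2) := by
  obtain ⟨h1, h2⟩ := slantProfile_mem_Icc hR hX
  have h3 := slantDamping_le_one hΘ hlam hXτ
  have h4 : 0 < slantDamping τ Θ lam X := Real.exp_pos _
  have hcoord : ∀ i, |slantPos z b τ Θ X i| ≤ R := fun i => by
    have := PiLp.norm_apply_le (slantPos z b τ Θ X) i
    exact (by simpa using this : |slantPos z b τ Θ X i| ≤ _).trans hX
  have hterm : ∀ i j, |a i j * barrierHess z b τ Θ R lam X (EuclideanSpace.single i 1) j| ≤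
      ν⁻¹ * (12 / R ^ 2) := by
    intro i j
    rw [abs_mul]
    refine mul_le_mul (hab i j) ?_ (abs_nonneg _) (by positivity)
    rw [barrierHess_single_apply, abs_mul, abs_of_pos h4]
    have h5 : |8 / R ^ 4 * (slantPos z b τ Θ X i * slantPos z b τ Θ X j)| ≤ 8 / R ^ 2 := by
      rw [abs_mul, abs_mul, abs_of_nonneg (by positivity : 0 ≤ 8 / R ^ 4)]
      calc 8 / R ^ 4 * (|slantPos z b τ Θ X i| * |slantPos z b τ Θ X j|)
          ≤ 8 / R ^ 4 * (R * R) := by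
            gcongr
            · exact hcoord i
            · exact hcoord j
        _ = 8 / R ^ 2 := by field_simp
    have h6 : |4 / R ^ 2 * slantProfile z b τ Θ R X * (if i = j then (1 : ℝ) else 0)| ≤
        4 / R ^ 2 := by
      rw [abs_mul, abs_mul, abs_of_nonneg (by positivity : 0 ≤ 4 / R ^ 2), abs_of_nonneg h1]
      have h7 : |if i = j then (1 : ℝ) else 0| ≤ 1 := by split_ifs <;> simp
      calc 4 / R ^ 2 * slantProfile z b τ Θ R X * |if i = j then (1 : ℝ) else 0|
          ≤ 4 / R ^ 2 * 1 * 1 := by gcongr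
        _ = 4 / R ^ 2 := by ring
    refine (mul_le_of_le_one_left (abs_nonneg _) h3).trans ((abs_sub _ _).trans ?_)
    calc _ ≤ 8 / R ^ 2 + 4 / R ^ 2 := add_le_add h5 h6
      _ = 12 / R ^ 2 := by ring
  calc _ ≤ ∑ i : Fin n, ∑ j : Fin n, ν⁻¹ * (12 / R ^ 2) :=
        (Finset.abs_sum_le_sum_abs _ _).trans (Finset.sum_le_sum fun i _ =>
          (Finset.abs_sum_le_sum_abs _ _).trans (Finset.sum_le_sum fun j _ => hterm i j))
    _ = 12 * n ^ 2 / (ν * R ^ 2) := by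
        simp only [Finset.sum_const, Finset.card_univ, Fintype.card_fin, nsmul_eq_mul]
        field_simp

end BarrierEstimates

/-! ### Means, time scales and oscillation of the weight. -/

section Weights

variable {n : ℕ} {ω : Space n → ℝ}

theorem volume_ball_real_pos (y : Space n) {r : ℝ} (hr : 0 < r) : 0 < volume.real (ball y r) :=
  ENNReal.toReal_pos (measure_ball_pos volume y hr).ne' measure_ball_lt_top.ne

theorem setAverage_ball_eq (f : Space n → ℝ) (y : Space n) (r : ℝ) :
    ⨍ x in ball y r, f x = (volume.real (ball y r))⁻¹ * ∫ x in ball y r, f x := by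
  rw [setAverage_eq, smul_eq_mul]

theorem MemAp.integrableOn_ball {p : ℝ} (hω : MemAp p ω) (y : Space n) (r : ℝ) :
    IntegrableOn ω (ball y r) :=
  (hω.locallyIntegrable.integrableOn_isCompact (isCompact_closedBall y r)).mono_set
    ball_subset_closedBall

theorem MemAp.setAverage_pos {p : ℝ} (hω : MemAp p ω) (y : Space n) {r : ℝ} (hr : 0 < r) :
    0 < ⨍ x in ball y r, ω x := by
  rw [setAverage_ball_eq]
  refine mul_pos (inv_pos.2 (volume_ball_real_pos y hr)) ?_
  rw [setIntegral_pos_iff_support_of_nonneg_ae (Eventually.of_forall hω.nonneg)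
    (hω.integrableOn_ball y r)]
  refine (measure_ball_pos volume y hr).trans_le (measure_mono_ae ?_)
  filter_upwards [hω.ae_pos] with x hx hxb
  exact ⟨hx.ne', hxb⟩

theorem MemAp.lintegral_ball {p : ℝ} (hω : MemAp p ω) (y : Space n) {r : ℝ} (hr : 0 < r) :
    ∫⁻ x in ball y r, ENNReal.ofReal (ω x) =
      volume (ball y r) * ENNReal.ofReal (⨍ x in ball y r, ω x) := by
  rw [← ofReal_integral_eq_lintegral_ofReal (hω.integrableOn_ball y r)
    (Eventually.of_forall hω.nonneg), setAverage_ball_eq,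
    ← ofReal_measureReal (measure_ball_lt_top (μ := volume)).ne,
    ← ENNReal.ofReal_mul measureReal_nonneg, mul_inv_cancel_left₀ (volume_ball_real_pos y hr).ne']

theorem meanENN_ofReal {p : ℝ} (hω : MemAp p ω) (y : Space n) {r : ℝ} (hr : 0 < r) :
    meanENN (fun x => ENNReal.ofReal (ω x)) y r = ENNReal.ofReal (⨍ x in ball y r, ω x) := by
  rw [meanENN, hω.lintegral_ball y hr,
    ENNReal.inv_mul_cancel_left (measure_ball_pos volume y hr).ne' measure_ball_lt_top.ne]

theorem ap_le_apConst {p : ℝ} (ω : Space n → ℝ) (y : Space n) {r : ℝ} (hr : 0 < r) :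
    meanENN (fun x => ENNReal.ofReal (ω x)) y r *
      meanENN (fun x => ENNReal.ofReal (ω x) ^ (-(1 / (p - 1)))) y r ^ (p - 1) ≤ apConst p ω :=
  le_iSup_of_le (f := fun _ => ⨆ (ρ : ℝ) (_ : 0 < ρ), _) y
    (le_iSup_of_le (f := fun ρ => ⨆ (_ : 0 < ρ), _) r (le_iSup_of_le hr le_rfl))

theorem meanOsc_le_bmoSeminorm {f : Space n → ℝ} {y : Space n} {r : ℝ} (hr : 0 < r)
    {Ω : Set (Space n)} (hΩ : ball y r ⊆ Ω) : meanOsc f ω y r ≤ bmoSeminorm f ω Ω := by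
  unfold bmoSeminorm
  exact (le_iSup₂ (f := fun (_ : 0 < r) (_ : ball y r ⊆ Ω) => meanOsc f ω y r) hr hΩ).trans
    (le_iSup₂ (f := fun (y : Space n) (r : ℝ) => ⨆ (_ : 0 < r) (_ : ball y r ⊆ Ω),
      meanOsc f ω y r) y r)

theorem dualWeight_nonneg (hω : ∀ x, 0 ≤ ω x) (x : Space n) : 0 ≤ dualWeight ω x :=
  inv_nonneg.2 (pow_nonneg (hω x) n)

/-- Where `ω = 0` the left side is `∞` while the real inverse gives `0`; this happens only on a null
set. -/
theorem MemAp.ofReal_rpow_ae_eq (hn : 1 ≤ n) (hω : MemAp (1 + 1 / (n : ℝ)) ω) :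
    (fun x => ENNReal.ofReal (ω x) ^ (-(1 / (1 + 1 / (n : ℝ) - 1)))) =ᵐ[volume]
      fun x => ENNReal.ofReal (dualWeight ω x) := by
  have hn' : (n : ℝ) ≠ 0 := by positivity
  filter_upwards [hω.ae_pos] with x hx
  have e : -(1 / (1 + 1 / (n : ℝ) - 1)) = -(n : ℝ) := by field_simp; ring
  rw [e, dualWeight, ENNReal.rpow_neg, ENNReal.rpow_natCast, ← ENNReal.ofReal_pow hx.le,
    ENNReal.ofReal_inv_of_pos (pow_pos hx n)]

theorem MemAp.mean_dual_lt_top (hn : 1 ≤ n) (hω : MemAp (1 + 1 / (n : ℝ)) ω) (y : Space n) {r : ℝ}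
    (hr : 0 < r) : ∫⁻ x in ball y r, ENNReal.ofReal (dualWeight ω x) < ∞ := by
  have hn' : (0 : ℝ) < n := by positivity
  have h1 : meanENN (fun x => ENNReal.ofReal (ω x)) y r *
      meanENN (fun x => ENNReal.ofReal (ω x) ^ (-(1 / (1 + 1 / (n : ℝ) - 1)))) y r
        ^ (1 + 1 / (n : ℝ) - 1) < ∞ := by
    exact (ap_le_apConst ω y hr).trans_lt hω.apConst_lt_top
  rw [meanENN_ofReal hω y hr] at h1
  have h2 : ENNReal.ofReal (⨍ x in ball y r, ω x) ≠ 0 := by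
    simpa using hω.setAverage_pos y hr
  have h3 := ENNReal.lt_top_of_mul_ne_top_right h1.ne h2
  have h4 : meanENN (fun x => ENNReal.ofReal (ω x) ^ (-(1 / (1 + 1 / (n : ℝ) - 1)))) y r < ∞ := by
    by_contra! h
    rw [top_le_iff.1 h, ENNReal.top_rpow_of_pos (by simpa using Nat.pos_of_ne_zero (by omega))] at h3
    exact lt_irrefl _ h3
  rw [meanENN] at h4
  have h5 := ENNReal.lt_top_of_mul_ne_top_right h4.ne
    (ENNReal.inv_ne_zero.2 measure_ball_lt_top.ne)
  rwa [lintegral_congr_ae (ae_restrict_of_ae (hω.ofReal_rpow_ae_eq hn))] at h5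

theorem MemAp.aestronglyMeasurable {p : ℝ} (hω : MemAp p ω) : AEStronglyMeasurable ω volume :=
  hω.locallyIntegrable.aestronglyMeasurable

theorem MemAp.integrableOn_dualWeight (hn : 1 ≤ n) (hω : MemAp (1 + 1 / (n : ℝ)) ω) (y : Space n)
    {r : ℝ} (hr : 0 < r) : IntegrableOn (dualWeight ω) (ball y r) := by
  have hm : AEStronglyMeasurable (dualWeight ω) volume :=
    (hω.aestronglyMeasurable.aemeasurable.pow_const n).inv.aestronglyMeasurable
  refine (lintegral_ofReal_ne_top_iff_integrable hm.restrict
    (Eventually.of_forall (dualWeight_nonneg hω.nonneg))).1 (hω.mean_dual_lt_top hn y hr).ne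

theorem MemAp.meanENN_dual (hn : 1 ≤ n) (hω : MemAp (1 + 1 / (n : ℝ)) ω) (y : Space n)
    {r : ℝ} (hr : 0 < r) :
    meanENN (fun x => ENNReal.ofReal (ω x) ^ (-(1 / (1 + 1 / (n : ℝ) - 1)))) y r =
      ENNReal.ofReal (⨍ x in ball y r, dualWeight ω x) := by
  rw [meanENN, lintegral_congr_ae (ae_restrict_of_ae (hω.ofReal_rpow_ae_eq hn)),
    ← ofReal_integral_eq_lintegral_ofReal (hω.integrableOn_dualWeight hn y hr)
    (Eventually.of_forall (dualWeight_nonneg hω.nonneg)), setAverage_ball_eq,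
    ENNReal.ofReal_mul (inv_nonneg.2 measureReal_nonneg),
    ENNReal.ofReal_inv_of_pos (volume_ball_real_pos y hr),
    ofReal_measureReal (measure_ball_lt_top (μ := volume)).ne]

theorem setAverage_dualWeight_nonneg (hω : ∀ x, 0 ≤ ω x) (y : Space n) (r : ℝ) :
    0 ≤ ⨍ x in ball y r, dualWeight ω x := by
  rw [setAverage_ball_eq]
  exact mul_nonneg (inv_nonneg.2 measureReal_nonneg)
    (integral_nonneg (dualWeight_nonneg hω))

theorem MemAp.setAverage_mul_timeScale_le (hn : 1 ≤ n) (hω : MemAp (1 + 1 / (n : ℝ)) ω)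
    {K₀ : ℝ} (hK₀ : 0 ≤ K₀) (hA : apConst (1 + 1 / (n : ℝ)) ω ≤ ENNReal.ofReal K₀) (y : Space n)
    {r : ℝ} (hr : 0 < r) : (⨍ x in ball y r, ω x) * timeScale (dualWeight ω) r y ≤ K₀ := by
  have h1 : meanENN (fun x => ENNReal.ofReal (ω x)) y r *
      meanENN (fun x => ENNReal.ofReal (ω x) ^ (-(1 / (1 + 1 / (n : ℝ) - 1)))) y r
        ^ (1 + 1 / (n : ℝ) - 1) ≤ ENNReal.ofReal K₀ :=
    (ap_le_apConst ω y hr).trans hA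
  rw [meanENN_ofReal hω y hr, hω.meanENN_dual hn y hr, add_sub_cancel_left,
    ENNReal.ofReal_rpow_of_nonneg (setAverage_dualWeight_nonneg hω.nonneg y r) (by positivity),
    ← ENNReal.ofReal_mul (hω.setAverage_pos y hr).le, ENNReal.ofReal_le_ofReal_iff hK₀] at h1
  exact h1

/-- Jensen's inequality for `t ↦ t⁻ⁿ`, obtained by integrating the tangent line at `t = c`. -/
theorem MemAp.one_le_setAverage_mul_timeScale (hn : 1 ≤ n) (hω : MemAp (1 + 1 / (n : ℝ)) ω)
    (y : Space n) {r : ℝ} (hr : 0 < r) :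
    1 ≤ (⨍ x in ball y r, ω x) * timeScale (dualWeight ω) r y := by
  set c := ⨍ x in ball y r, ω x with hc
  have hc0 : 0 < c := hω.setAverage_pos y hr
  have hpt : ∀ᵐ x ∂volume.restrict (ball y r),
      (c ^ n)⁻¹ * (n + 1) - (c ^ n)⁻¹ * n / c * ω x ≤ dualWeight ω x := by
    filter_upwards [ae_restrict_of_ae hω.ae_pos] with x hx
    -- Bernoulli with exponent `n + 1` at `c/ω`, multiplied by `ω/c`, is the tangent-line bound
    -- `(c/ω)ⁿ ≥ n + 1 - n ω/c`.
    have h1 := one_add_mul_le_pow (a := c / ω x - 1) (by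
      have : 0 ≤ c / ω x := by positivity
      linarith) (n + 1)
    rw [add_sub_cancel] at h1
    have h2 : (n + 1) - n * (ω x / c) ≤ (c / ω x) ^ n := by
      have h3 : (c / ω x) ^ (n + 1) * (ω x / c) = (c / ω x) ^ n := by
        rw [pow_succ]; field_simp
      rw [← h3]
      have h4 := mul_le_mul_of_nonneg_right h1 (by positivity : 0 ≤ ω x / c)
      refine le_trans (le_of_eq ?_) h4
      push_cast; field_simp; ring
    have h5 := mul_le_mul_of_nonneg_left h2 (by positivity : 0 ≤ (c ^ n)⁻¹)
    have h6 : (c ^ n)⁻¹ * (c / ω x) ^ n = dualWeight ω x := by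
      rw [dualWeight, div_pow]; field_simp
    rw [h6] at h5
    refine le_trans (le_of_eq ?_) h5
    ring
  have hV := volume_ball_real_pos y hr
  have hωi := hω.integrableOn_ball y r
  have hci : IntegrableOn (fun _ => (c ^ n)⁻¹ * ((n : ℝ) + 1)) (ball y r) :=
    integrableOn_const measure_ball_lt_top.ne
  have hint := integral_mono_ae (hci.sub (hωi.const_mul ((c ^ n)⁻¹ * n / c))) (hω.integrableOn_dualWeight hn y hr) hpt
  have hωV : ∫ x in ball y r, ω x = volume.real (ball y r) * c := by
    rw [hc, setAverage_ball_eq, mul_inv_cancel_left₀ hV.ne']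
  have hlow : (c ^ n)⁻¹ ≤ ⨍ x in ball y r, dualWeight ω x := by
    rw [setAverage_ball_eq, inv_mul_eq_div, le_div_iff₀ hV]
    refine le_trans (le_of_eq ?_) hint
    simp only [Pi.sub_apply]
    rw [integral_sub hci (hωi.const_mul _), integral_const_mul ((c ^ n)⁻¹ * n / c), hωV,
      setIntegral_const, smul_eq_mul]
    field_simp
    ring
  have hT : c⁻¹ ≤ timeScale (dualWeight ω) r y := by
    have := Real.rpow_le_rpow (by positivity) hlow (by positivity : 0 ≤ 1 / (n : ℝ))
    rwa [← inv_pow, one_div (n : ℝ), Real.pow_rpow_inv_natCast (by positivity) (by omega), inv_eq_one_div (n : ℝ)] at this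
  calc 1 = c * c⁻¹ := (mul_inv_cancel₀ hc0.ne').symm
    _ ≤ _ := by gcongr

theorem volume_real_ball (y : Space n) {r : ℝ} (hr : 0 < r) :
    volume.real (ball y r) = r ^ n * volume.real (ball (0 : Space n) 1) := by
  rw [Measure.real, Measure.addHaar_ball_of_pos volume y hr, ENNReal.toReal_mul,
    ENNReal.toReal_ofReal (by positivity), Measure.real]
  simp

/-- Halving the radius divides the volume by `2ⁿ`, and the `n`-th root turns this into a factor 2.
-/
theorem MemAp.timeScale_half_le (hn : 1 ≤ n) (hω : MemAp (1 + 1 / (n : ℝ)) ω)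
    (y : Space n) {r : ℝ} (hr : 0 < r) :
    timeScale (dualWeight ω) (r / 2) y ≤ 2 * timeScale (dualWeight ω) r y := by
  have h1 : ⨍ x in ball y (r / 2), dualWeight ω x ≤ 2 ^ n * ⨍ x in ball y r, dualWeight ω x := by
    have h2 : ∫ x in ball y (r / 2), dualWeight ω x ≤ ∫ x in ball y r, dualWeight ω x :=
      setIntegral_mono_set (hω.integrableOn_dualWeight hn y hr)
        (Eventually.of_forall (dualWeight_nonneg hω.nonneg))
        (ball_subset_ball (show r / 2 ≤ r by linarith)).eventuallyLE
    rw [setAverage_ball_eq, setAverage_ball_eq, volume_real_ball y hr,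
      volume_real_ball y (half_pos hr)]
    have hV := volume_ball_real_pos (0 : Space n) one_pos
    calc _ ≤ ((r / 2) ^ n * volume.real (ball (0 : Space n) 1))⁻¹ *
          ∫ x in ball y r, dualWeight ω x := by gcongr
      _ = _ := by rw [div_pow]; field_simp
  have h3 := Real.rpow_le_rpow (setAverage_dualWeight_nonneg hω.nonneg y _) h1
    (by positivity : 0 ≤ 1 / (n : ℝ))
  rw [Real.mul_rpow (by positivity) (setAverage_dualWeight_nonneg hω.nonneg y _), one_div (n : ℝ),
    Real.pow_rpow_inv_natCast (by positivity) (by omega), inv_eq_one_div (n : ℝ)] at h3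
  exact h3

/-- The weighted oscillation integral on a ball, controlled by the `BMO` seminorm. -/
theorem MemAp.lintegral_oscillation_le {p : ℝ} (hω : MemAp p ω) {y : Space n} {r ε : ℝ} (hr : 0 < r)
    {Ω : Set (Space n)} (hΩ : ball y r ⊆ Ω) (hε : bmoSeminorm ω ω Ω ≤ ENNReal.ofReal ε) :
    ∫⁻ x in ball y r, ENNReal.ofReal (|ω x - ⨍ z in ball y r, ω z| ^ (n + 1)) *
      ((ENNReal.ofReal (ω x)) ^ n)⁻¹ ≤
      ENNReal.ofReal ε ^ (n + 1) *
        (volume (ball y r) * ENNReal.ofReal (⨍ x in ball y r, ω x)) := by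
  have h1 : meanOsc ω ω y r ≤ ENNReal.ofReal ε :=
    (meanOsc_le_bmoSeminorm hr hΩ).trans hε
  rw [meanOsc, hω.lintegral_ball y hr] at h1
  have h2 := ENNReal.rpow_le_rpow h1 (by positivity : (0 : ℝ) ≤ (n : ℝ) + 1)
  rw [← ENNReal.rpow_mul, one_div_mul_cancel (by positivity), ENNReal.rpow_one] at h2
  have h3 : ENNReal.ofReal ε ^ ((n : ℝ) + 1) = ENNReal.ofReal ε ^ (n + 1) := by
    rw [← ENNReal.rpow_natCast]; push_cast; rfl
  rw [h3] at h2
  have h4 : volume (ball y r) * ENNReal.ofReal (⨍ x in ball y r, ω x) ≠ 0 :=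
    mul_ne_zero (measure_ball_pos volume y hr).ne' (by simpa using hω.setAverage_pos y hr)
  have h5 : volume (ball y r) * ENNReal.ofReal (⨍ x in ball y r, ω x) ≠ ∞ :=
    ENNReal.mul_ne_top measure_ball_lt_top.ne ENNReal.ofReal_ne_top
  rwa [← ENNReal.div_eq_inv_mul, ENNReal.div_le_iff h4 h5] at h2

end Weights

/-! ### Comparison with the barrier and conclusion. -/

/-- Since the right-hand side `C |ω - c|` does not depend on time, the space-time integral splits
into a duration times the oscillation integral of the weight. -/
theorem ContactData.volume_le_of_subsolution {n : ℕ} {K U : Set (SpaceTime n)} {T : ℝ}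
    {w wt : SpaceTime n → ℝ} {Dw : SpaceTime n → Space n}
    {A : SpaceTime n → Space n →L[ℝ] Space n} (H : ContactData K U T w wt Dw A)
    {X₁ : SpaceTime n} (hX₁ : X₁ ∈ K) {m d : ℝ} (hm : 0 < m) (hd : 0 < d) (hwm : w X₁ = m)
    (hdiam : ∀ X ∈ K, ‖X.1 - X₁.1‖ ≤ d) {y : Space n} {r τ : ℝ} (hK : K ⊆ ball y r ×ˢ Icc τ T)
    {ω : Space n → ℝ} (hω : AEMeasurable ω volume) {ν C c : ℝ} (hν : 0 < ν) (hC : 0 ≤ C)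
    (hL : ∀ᵐ X ∂(volume : Measure (SpaceTime n)), X ∈ U → X.2 ≤ T → 0 < ω X.1 ∧
      ∃ a : Matrix (Fin n) (Fin n) ℝ,
        (∀ ξ : Space n, ν * ‖ξ‖ ^ 2 ≤ ∑ i, ∑ j, a i j * ξ i * ξ j) ∧
        wt X - ω X.1 * ∑ i, ∑ j, a i j * A X (EuclideanSpace.single i 1) j ≤ C * |ω X.1 - c|) :
    volume (ball (0 : Space n) (m / (4 * d))) * ENNReal.ofReal (m / 2) ≤
      2 * (ENNReal.ofReal (n.factorial * C ^ (n + 1) / ν ^ n) * ENNReal.ofReal (T - τ) *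
        ∫⁻ x in ball y r, ENNReal.ofReal (|ω x - c| ^ (n + 1)) * (ENNReal.ofReal (ω x) ^ n)⁻¹) := by
  have hm4 : 0 < m / 4 := by positivity
  refine (H.volume_le_lintegral_contactSet hX₁ hm hd hwm hdiam).trans ?_
  gcongr
  set G : Space n → ℝ≥0∞ := fun x =>
    ENNReal.ofReal (|ω x - c| ^ (n + 1)) * (ENNReal.ofReal (ω x) ^ n)⁻¹ with hG
  set k : ℝ≥0∞ := ENNReal.ofReal (n.factorial * C ^ (n + 1) / ν ^ n) with hk
  have hGm : AEMeasurable G volume := by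
    have h1 : AEMeasurable (fun x => |ω x - c| ^ (n + 1)) volume := by
      simpa only [Real.norm_eq_abs] using (hω.sub_const c).norm.pow_const (n + 1)
    exact h1.ennreal_ofReal.mul (hω.ennreal_ofReal.pow_const n).inv
  have hpt : ∀ᵐ X ∂(volume.restrict (contactSet K w Dw (m / 4))),
      ENNReal.ofReal (wt X) * ENNReal.ofReal |(A X).det| ≤ k * (G X.1 * 1) := by
    filter_upwards [ae_restrict_of_ae hL,
      ae_restrict_mem (H.isCompact_contactSet hm4).measurableSet] with X hX hXΓ
    have hXU := H.contactSet_subset hm4 hXΓ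
    obtain ⟨hpos, a, ha, hf⟩ := hX hXU (H.le_of_mem X hXΓ.1)
    have hwt := H.time_deriv_nonneg hm4 hXΓ
    have h1 := mul_abs_det_le hν hpos hwt ha (H.hess_symm H.isOpen hXU)
      (H.hess_nonpos hm4 hXΓ) hf
    simp only [hG, hk, mul_one]
    rw [← ENNReal.ofReal_mul hwt, ← ENNReal.ofReal_pow hpos.le,
      ← ENNReal.ofReal_inv_of_pos (by positivity), ← ENNReal.ofReal_mul (by positivity),
      ← ENNReal.ofReal_mul (by positivity)]
    refine ENNReal.ofReal_le_ofReal (h1.trans (le_of_eq ?_))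
    rw [mul_pow, mul_pow]
    field_simp
  calc ∫⁻ X in contactSet K w Dw (m / 4), ENNReal.ofReal (wt X) * ENNReal.ofReal |(A X).det|
      ≤ ∫⁻ X in contactSet K w Dw (m / 4), k * (G X.1 * 1) := lintegral_mono_ae hpt
    _ ≤ ∫⁻ X in ball y r ×ˢ Icc τ T, k * (G X.1 * 1) :=
        lintegral_mono_set fun X hX => hK hX.1
    _ = k * ∫⁻ X in ball y r ×ˢ Icc τ T, G X.1 * 1 := lintegral_const_mul' _ _ ENNReal.ofReal_ne_top
    _ = k * ENNReal.ofReal (T - τ) * ∫⁻ x in ball y r, G x := by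
        rw [Measure.volume_eq_prod, ← Measure.prod_restrict,
          lintegral_prod_mul (g := fun _ => 1) hGm.restrict aemeasurable_const, setLIntegral_const,
          Real.volume_Icc, one_mul]
        ring

/-- The maximum of a subsolution is controlled by the oscillation of the weight. -/
theorem max_le_of_volume_le {n : ℕ} {m r R q M ε ν K₀ c T Θ G : ℝ} {J : ℝ≥0∞} {y : Space n}
    (hm : 0 < m) (hr : 0 < r) (hR : 0 < R) (hq : r = 2 * q * R) (hM : 0 ≤ M) (hε : 0 ≤ ε)
    (hν : 0 < ν) (hc : 0 ≤ c) (hcT : c * T ≤ K₀) (hΘ : 0 ≤ Θ) (hΘT : Θ ≤ r ^ 2 * T)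
    (hG : 1 ≤ G)
    (hG' : 4 * 8 ^ n * n.factorial / ν ^ n * (12 * n ^ 2 / ν * (4 * q ^ 2)) ^ (n + 1) * K₀ ≤ G)
    (hJ : J ≤ ENNReal.ofReal ε ^ (n + 1) * (volume (ball y r) * ENNReal.ofReal c))
    (hvol : volume (ball (0 : Space n) (m / (4 * (2 * r)))) * ENNReal.ofReal (m / 2) ≤
      2 * (ENNReal.ofReal (n.factorial * (M * (12 * n ^ 2 / (ν * R ^ 2))) ^ (n + 1) / ν ^ n) *
        ENNReal.ofReal Θ * J)) : m ≤ G * ε * M := by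
  set V := volume.real (ball (0 : Space n) 1) with hV
  have hVpos : 0 < V := volume_ball_real_pos 0 one_pos
  have h1 := hvol.trans (mul_le_mul_right (mul_le_mul_right hJ _) _)
  rw [← ofReal_measureReal (measure_ball_lt_top (μ := volume)).ne,
    ← ofReal_measureReal (measure_ball_lt_top (μ := volume)).ne, volume_real_ball _ hr,
    volume_real_ball _ (by positivity), ← hV, ← ENNReal.ofReal_pow hε,
    show (2 : ℝ≥0∞) = ENNReal.ofReal 2 by simp] at h1
  rw [← ENNReal.ofReal_mul (by positivity), ← ENNReal.ofReal_mul (by positivity),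
    ← ENNReal.ofReal_mul (by positivity), ← ENNReal.ofReal_mul (by positivity),
    ← ENNReal.ofReal_mul (by positivity), ← ENNReal.ofReal_mul (by positivity),
    ENNReal.ofReal_le_ofReal_iff (by positivity)] at h1
  have h2 : c * Θ ≤ r ^ 2 * K₀ := by
    calc c * Θ ≤ c * (r ^ 2 * T) := by gcongr
      _ = r ^ 2 * (c * T) := by ring
      _ ≤ _ := by gcongr
  obtain ⟨D, hD⟩ : ∃ D, D = 12 * (n : ℝ) ^ 2 / ν := ⟨_, rfl⟩
  have hD0 : 0 ≤ D := by rw [hD]; positivity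
  have hDR : M * (12 * n ^ 2 / (ν * R ^ 2)) = M * D / R ^ 2 := by rw [hD]; field_simp
  rw [hDR] at h1
  have h3 : m ^ (n + 1) ≤ 4 * 8 ^ n * n.factorial / ν ^ n * (M * D / R ^ 2) ^ (n + 1) *
      (r ^ 2) ^ n * ε ^ (n + 1) * (c * Θ) := by
    have e1 : (m / (4 * (2 * r))) ^ n * V * (m / 2) = m ^ (n + 1) * (V / (2 * 8 ^ n * r ^ n)) := by
      rw [div_pow, show 4 * (2 * r) = 8 * r by ring, mul_pow, pow_succ]; field_simp
    have e2 : 2 * (n.factorial * (M * D / R ^ 2) ^ (n + 1) / ν ^ n * Θ *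
        (ε ^ (n + 1) * (r ^ n * V * c))) = (4 * 8 ^ n * n.factorial / ν ^ n *
        (M * D / R ^ 2) ^ (n + 1) * (r ^ 2) ^ n * ε ^ (n + 1) * (c * Θ)) *
        (V / (2 * 8 ^ n * r ^ n)) := by
      rw [← pow_mul, mul_comm 2 n, pow_mul]; field_simp; ring
    rw [e1, e2] at h1
    exact le_of_mul_le_mul_right h1 (by positivity)
  have h4 : m ^ (n + 1) ≤ (G * ε * M) ^ (n + 1) := by
    calc m ^ (n + 1) ≤ 4 * 8 ^ n * n.factorial / ν ^ n * (M * D / R ^ 2) ^ (n + 1) *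
          (r ^ 2) ^ n * ε ^ (n + 1) * (r ^ 2 * K₀) := by
          refine h3.trans ?_
          gcongr
      _ = (4 * 8 ^ n * n.factorial / ν ^ n * (D * (4 * q ^ 2)) ^ (n + 1) * K₀) *
          (ε * M) ^ (n + 1) := by
          -- Here the scales cancel: only the ratio `r² / R² = 4q²` survives.
          have e3 : r ^ 2 = 4 * q ^ 2 * R ^ 2 := by rw [hq]; ring
          have e4 : (M * D / R ^ 2) ^ (n + 1) * ((r ^ 2) ^ n * r ^ 2) =
              (D * (4 * q ^ 2)) ^ (n + 1) * M ^ (n + 1) := by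
            rw [← pow_succ, ← mul_pow, ← mul_pow, e3]
            congr 1; field_simp
          rw [mul_pow ε M]
          linear_combination (4 * 8 ^ n * n.factorial / ν ^ n * ε ^ (n + 1) * K₀) * e4
      _ ≤ G * (ε * M) ^ (n + 1) := by
          gcongr
          rw [hD]; exact hG'
      -- As `G ≥ 1`, passing to `G ^ (n + 1)` avoids an `(n + 1)`-th root in the constant.
      _ ≤ G ^ (n + 1) * (ε * M) ^ (n + 1) := by
          gcongr
          exact le_self_pow₀ hG (by omega)
      _ = (G * ε * M) ^ (n + 1) := by rw [← mul_pow]; ring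
  exact le_of_pow_le_pow_left₀ (by omega) (by positivity) h4

/-- The second growth lemma at a single point, with explicit constants. -/
theorem growth_at_point {n : ℕ} (hn : 1 ≤ n) {ν K₀ h q lam G ε r ρ s τ M : ℝ} (hν : 0 < ν)
    (hK₀ : 1 ≤ K₀) (hh₀ : 0 < h) (hh₁ : h ≤ 1) (hlam0 : 0 ≤ lam)
    (hlam : (16 * q + 4 * q ^ 2 * K₀ * (8 * ν + 4 * n / ν)) ^ 2 ≤ lam * (32 * ν * (4 * h)))
    (hG : 1 ≤ G)
    (hG' : 4 * 8 ^ n * n.factorial / ν ^ n * (12 * n ^ 2 / ν * (4 * q ^ 2)) ^ (n + 1) * K₀ ≤ G)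
    (hε : 0 ≤ ε) (hρ : 0 < ρ) (hρr : ρ ≤ r) (hq : r / ρ = q) {y : Space n} {ω : Space n → ℝ}
    {a : SpaceTime n → Matrix (Fin n) (Fin n) ℝ} (hω : MemAp (1 + 1 / (n : ℝ)) ω)
    (hA : apConst (1 + 1 / (n : ℝ)) ω ≤ ENNReal.ofReal K₀)
    (hbmo : bmoSeminorm ω ω (ball y (2 * r)) ≤ ENNReal.ofReal ε)
    (ha : IsElliptic ν a (weightedCylinder (dualWeight ω) h r (y, s)))
    {u : SpaceTime n → ℝ} (hu : IsC21On u (weightedCylinder (dualWeight ω) h r (y, s)))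
    (huc : ContinuousOn u (closure (weightedCylinder (dualWeight ω) h r (y, s))))
    (hLu : ∀ᵐ X ∂(volume : Measure (SpaceTime n)),
      X ∈ weightedCylinder (dualWeight ω) h r (y, s) → parabolicOp ω a u X ≤ 0)
    {z : Space n} (hz : ball z ρ ⊆ ball y r)
    (hτ₀ : s - h * r ^ 2 * timeScale (dualWeight ω) r y ≤ τ)
    (hτ₁ : τ ≤ s - h * (r ^ 2 / 2 + ρ ^ 2) * timeScale (dualWeight ω) r y)
    (huτ : ∀ x ∈ ball z ρ, u (x, τ) ≤ 0)
    (hM : 0 ≤ M) (huM : ∀ X ∈ weightedCylinder (dualWeight ω) h r (y, s), u X ≤ M)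
    {X₁ : SpaceTime n} (hX₁ : X₁ ∈ weightedCylinder (dualWeight ω) h (r / 2) (y, s)) :
    u X₁ ≤ M - M * Real.exp (-lam) + G * ε * M := by
  have hr : 0 < r := hρ.trans_le hρr
  set C := weightedCylinder (dualWeight ω) h r (y, s) with hC
  set T := timeScale (dualWeight ω) r y with hT
  set c := ⨍ x in ball y r, ω x with hc
  have hc0 : 0 < c := hω.setAverage_pos y hr
  have hcT₁ : 1 ≤ c * T := hω.one_le_setAverage_mul_timeScale hn y hr
  have hcTK : c * T ≤ K₀ := hω.setAverage_mul_timeScale_le hn (by linarith) hA y hr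
  have hT0 : 0 < T := by
    by_contra! hneg
    nlinarith
  obtain ⟨x₁, t₁⟩ := X₁
  obtain ⟨hx₁, ht₁, ht₁s⟩ := hX₁
  dsimp only at hx₁ ht₁ ht₁s
  have hCopen : IsOpen C := isOpen_ball.prod isOpen_Ioo
  -- The half-size cylinder lasts at most `h (r/2)² · 2T = h r² T / 2`; with `hτ₁` this leaves `Θ ≥
  -- h ρ² T`.
  have htop : s - h * r ^ 2 / 2 * T < t₁ := by
    refine lt_of_le_of_lt ?_ ht₁
    have h1 := hω.timeScale_half_le hn y hr
    have h2 := mul_le_mul_of_nonneg_left h1 (by positivity : 0 ≤ h * (r / 2) ^ 2)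
    rw [← hT] at h2
    nlinarith
  -- With this radius the base lies in `B_ρ(z)` and, since `x₁ ∈ B_{r/2}(y)` and `ρ ≤ r`, the top
  -- lies in `B_r(y)`; convexity covers the sections between.
  set R := ρ / 2 with hRdef
  have hR : 0 < R := half_pos hρ
  have hq0 : 0 < q := by rw [← hq]; positivity
  have hrq : r = 2 * q * R := by rw [hRdef, ← hq]; field_simp
  set Θ := t₁ - τ with hΘdef
  have hΘlow : h * ρ ^ 2 * T ≤ Θ := by nlinarith
  have hΘpos : 0 < Θ := lt_of_lt_of_le (by positivity) hΘlow
  have hΘup' : Θ ≤ h * r ^ 2 * T := by linarith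
  have hΘup : Θ ≤ r ^ 2 * T := by
    refine hΘup'.trans ?_
    rw [mul_assoc]
    exact mul_le_of_le_one_left (by positivity) hh₁
  have hbase : s - h * r ^ 2 * T < t₁ := by nlinarith [mul_pos (mul_pos hh₀ (pow_pos hr 2)) hT0]
  set b := x₁ - z with hb
  have hzy : z ∈ ball y r := hz (mem_ball_self hρ)
  have hx₁r : x₁ ∈ ball y r := ball_subset_ball (by linarith) hx₁
  have hbn : ‖b‖ ≤ 4 * q * R := by
    have h1 : dist x₁ z ≤ dist x₁ y + dist y z := dist_triangle _ _ _
    rw [mem_ball] at hzy hx₁r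
    rw [hb, ← dist_eq_norm]
    rw [dist_comm z y] at hzy
    linarith
  -- the slanted cylinder
  let K : Set (SpaceTime n) := {X | τ ≤ X.2 ∧ X.2 ≤ t₁ ∧ ‖slantPos z b τ Θ X‖ ≤ R}
  -- `U` continues beyond time `t₁`, so derivatives at the top of `K` are two-sided.
  let U : Set (SpaceTime n) := C ∩ {X | τ < X.2 ∧ ‖slantPos z b τ Θ X‖ < R}
  have hpos := continuous_slantPos z b τ Θ
  have hUopen : IsOpen U := by
    refine hCopen.inter ?_
    exact (isOpen_lt continuous_const continuous_snd).inter (isOpen_lt hpos.norm continuous_const)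
  have hKball : ∀ X ∈ K, X.1 ∈ ball y r := by
    rintro ⟨x, t⟩ ⟨h1, h2, h3⟩
    dsimp only at h1 h2 h3 ⊢
    set ξ := slantPos z b τ Θ (x, t) with hξ
    have h4 : z + ξ ∈ ball y r := hz (by
      rw [mem_ball, dist_eq_norm, add_sub_cancel_left]; linarith)
    have h5 : x₁ + ξ ∈ ball y r := by
      rw [mem_ball, dist_eq_norm] at hx₁ ⊢
      rw [add_sub_right_comm]
      linarith [norm_add_le (x₁ - y) ξ]
    have hs0 : 0 ≤ (t - τ) / Θ := div_nonneg (by linarith) hΘpos.le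
    have hs1 : (t - τ) / Θ ≤ 1 := (div_le_one hΘpos).2 (by linarith)
    have h6 := convex_ball y r h4 h5 (sub_nonneg.2 hs1) hs0 (by ring)
    have h7 : x = (1 - (t - τ) / Θ) • (z + ξ) + ((t - τ) / Θ) • (x₁ + ξ) := by
      rw [hξ, slantPos, hb]; module
    rw [h7]; exact h6
  have hKC : ∀ X ∈ K, τ < X.2 → X ∈ C := fun X hX hXτ =>
    ⟨hKball X hX, hτ₀.trans_lt hXτ, hX.2.1.trans_lt ht₁s⟩
  have hKclosed : IsClosed K :=
    (isClosed_le continuous_const continuous_snd).inter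
      ((isClosed_le continuous_snd continuous_const).inter (isClosed_le hpos.norm continuous_const))
  have hKcompact : IsCompact K :=
    ((isCompact_closedBall y r).prod (isCompact_Icc (a := τ) (b := t₁))).of_isClosed_subset
      hKclosed fun X hX => ⟨ball_subset_closedBall (hKball X hX), hX.1, hX.2.1⟩
  -- `τ` may be the initial time of the cylinder, where `u` is only known to be continuous up to the
  -- boundary.
  have hKcl : K ⊆ closure C := by
    intro X hX
    rw [hC, weightedCylinder, closure_prod_eq, closure_Ioo (by
      have : 0 < h * r ^ 2 * T := by positivity
      dsimp only; rw [← hT]; linarith)]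
    exact ⟨subset_closure (hKball X hX), hτ₀.trans hX.1, hX.2.1.trans ht₁s.le⟩
  -- the comparison function
  let w : SpaceTime n → ℝ := fun X => u X + M * barrier z b τ Θ R lam X + -M
  have hwpos : ∀ X ∈ K, 0 < w X → X ∈ U := by
    intro X hX hwX
    obtain ⟨hv0, hv1⟩ := barrier_mem_Icc hΘpos hR hlam0 hX.1 hX.2.2
    have hXτ : τ < X.2 := by
      refine lt_of_le_of_ne hX.1 fun heq => ?_
      have h1 : slantPos z b τ Θ X = X.1 - z := by simp [slantPos, ← heq]
      have h2 : X.1 ∈ ball z ρ := by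
        rw [mem_ball, dist_eq_norm, ← h1]; linarith [hX.2.2]
      have h3 : u X ≤ 0 := by
        have := huτ X.1 h2
        rwa [heq] at this
      have h4 := mul_le_mul_of_nonneg_left hv1 hM
      simp only [w] at hwX
      linarith
    refine ⟨hKC X hX hXτ, hXτ, lt_of_le_of_ne hX.2.2 fun heq => ?_⟩
    have h1 : barrier z b τ Θ R lam X = 0 := by
      have : slantProfile z b τ Θ R X = 0 := by
        rw [slantProfile, heq, div_self (by positivity), sub_self]
      simp [barrier, this]
    have h2 := huM X (hKC X hX hXτ)
    simp only [w, h1] at hwX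
    linarith
  have H : ContactData K U t₁ w _ _ _ :=
    { ((hu.hasC21Derivs hCopen).mono inter_subset_left).add_const_smul
        ((hasC21Derivs_barrier z b τ Θ R lam).mono (subset_univ U)) M (-M) with
      isCompact := hKcompact
      isOpen := hUopen
      mem_of_le := fun X hX hXt => ⟨hX.2.1.le, hXt, hX.2.2.le⟩
      le_of_mem := fun X hX => hX.2.1
      mem_of_pos := hwpos
      cont := ((huc.mono hKcl).add
        (continuous_const.mul (continuous_barrier z b τ Θ R lam)).continuousOn).add
          continuousOn_const }
  have hpos₁ : slantPos z b τ Θ (x₁, t₁) = 0 := by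
    rw [slantPos, ← hΘdef, div_self hΘpos.ne', one_smul, hb]; abel
  have hX₁K : ((x₁, t₁) : SpaceTime n) ∈ K :=
    ⟨by dsimp only; linarith, le_rfl, by rw [hpos₁, norm_zero]; exact hR.le⟩
  have hw₁ : w (x₁, t₁) = u (x₁, t₁) + M * Real.exp (-lam) - M := by
    have h1 : slantDamping τ Θ lam ((x₁, t₁) : SpaceTime n) = Real.exp (-lam) := by
      rw [slantDamping, ← hΘdef]; congr 1; field_simp
    simp only [w, barrier, slantProfile, hpos₁, h1]
    simp
    ring
  rcases le_or_gt (w (x₁, t₁)) 0 with hneg | hwm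
  · have : 0 ≤ G * ε * M := by positivity
    linarith
  have hdiam : ∀ X ∈ K, ‖X.1 - ((x₁, t₁) : SpaceTime n).1‖ ≤ 2 * r := by
    intro X hX
    have h1 := hKball X hX
    have h2 := dist_triangle_right X.1 x₁ y
    rw [mem_ball] at h1 hx₁r
    rw [← dist_eq_norm]
    linarith
  -- Jensen gives the lower bound on `cΘ/R²`, and the `A_{1+1/n}` bound gives the upper one below.
  have hN₀c : 4 * h * R ^ 2 ≤ c * Θ := by
    calc 4 * h * R ^ 2 = h * ρ ^ 2 * 1 := by rw [hRdef]; ring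
      _ ≤ h * ρ ^ 2 * (c * T) := by gcongr
      _ = c * (h * ρ ^ 2 * T) := by ring
      _ ≤ c * Θ := by gcongr
  have hN₁c : c * Θ ≤ 4 * q ^ 2 * K₀ * R ^ 2 := by
    calc c * Θ ≤ c * (r ^ 2 * T) := by gcongr
      _ = r ^ 2 * (c * T) := by ring
      _ ≤ r ^ 2 * K₀ := by gcongr
      _ = _ := by rw [hrq]; ring
  have hωfst : ∀ᵐ X ∂(volume : Measure (SpaceTime n)), 0 < ω X.1 :=
    Measure.quasiMeasurePreserving_fst.ae hω.ae_pos
  have hvol := H.volume_le_of_subsolution hX₁K hwm (by positivity : 0 < 2 * r) rfl hdiam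
    (y := y) (r := r) (τ := τ) (fun X hX => ⟨hKball X hX, hX.1, hX.2.1⟩)
    hω.aestronglyMeasurable.aemeasurable (ν := ν) (C := M * (12 * n ^ 2 / (ν * R ^ 2))) (c := c) hν
    (by positivity) (by
      filter_upwards [hLu, hωfst] with X hLX hωX hXU _
      have hXC : X ∈ C := hXU.1
      have hXR := hXU.2.2.le
      refine ⟨hωX, a X, ha.elliptic X hXC, ?_⟩
      have h1 := hLX hXC
      have h2 := barrier_subsolution hΘpos hR hν hbn (by positivity) hN₀c hN₁c hlam
        (ha.elliptic X hXC) (ha.bounded X hXC) hXR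
      have h3 := abs_sum_mul_barrierHess_le (lam := lam) hν hΘpos hR hlam0 (ha.bounded X hXC)
        hXU.2.1.le hXR
      set S := ∑ i, ∑ j, a X i j * barrierHess z b τ Θ R lam X (EuclideanSpace.single i 1) j
        with hS
      have e1 : ∑ i, ∑ j, a X i j *
          (hessX u X + M • barrierHess z b τ Θ R lam X) (EuclideanSpace.single i 1) j =
          (∑ i, ∑ j, a X i j * dx i (dx j u) X) + M * S := by
        rw [hS, Finset.mul_sum, ← Finset.sum_add_distrib]
        refine Finset.sum_congr rfl fun i _ => ?_
        rw [Finset.mul_sum, ← Finset.sum_add_distrib]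
        refine Finset.sum_congr rfl fun j _ => ?_
        rw [← hessX_single_apply]
        simp only [_root_.add_apply, _root_.smul_apply, PiLp.add_apply, PiLp.smul_apply,
          smul_eq_mul]
        ring
      rw [e1]
      rw [parabolicOp] at h1
      -- The true operator applied to the barrier is the frozen one plus `(c - ω) S`.
      have h4 : (c - ω X.1) * S ≤ |ω X.1 - c| * (12 * n ^ 2 / (ν * R ^ 2)) := by
        refine (le_abs_self _).trans ?_
        rw [abs_mul, abs_sub_comm]
        gcongr
      have h5 : barrierT z b τ Θ R lam X - ω X.1 * S ≤
          |ω X.1 - c| * (12 * n ^ 2 / (ν * R ^ 2)) := by linarith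
      have h6 := mul_le_mul_of_nonneg_left h5 hM
      linarith)
  have hJ := hω.lintegral_oscillation_le hr
    (ball_subset_ball (by linarith : r ≤ 2 * r)) hbmo
  have := max_le_of_volume_le hwm hr hR hrq hM hε hν hc0.le hcTK hΘpos.le hΘup hG hG'
    hJ hvol
  linarith

end WeightedParabolic

open WeightedParabolic
theorem proposition3p4 (n : ℕ) (hn : 1 ≤ n) (ν : ℝ) (hν₀ : 0 < ν) (hν₁ : ν < 1)
    (K₀ : ℝ) (hK₀ : 1 ≤ K₀) (h : ℝ) (hh₀ : 0 < h) (hh₁ : h ≤ 1) (q : ℝ) :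
    ∃ ε₂ β₂ : ℝ, (0 < ε₂ ∧ ε₂ < 1) ∧ (0 < β₂ ∧ β₂ < 1) ∧
      ∀ (r ρ : ℝ), 0 < ρ → ρ ≤ r → r / ρ = q →
      ∀ (y : Space n) (s : ℝ) (ω : Space n → ℝ) (a : SpaceTime n → Matrix (Fin n) (Fin n) ℝ),
        MemAp (1 + 1 / (n : ℝ)) ω →
        apConst (1 + 1 / (n : ℝ)) ω ≤ ENNReal.ofReal K₀ →
        bmoSeminorm ω ω (ball y (2 * r)) ≤ ENNReal.ofReal ε₂ →
        IsElliptic ν a (weightedCylinder (dualWeight ω) h r (y, s)) →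
      ∀ u : SpaceTime n → ℝ,
        IsC21On u (weightedCylinder (dualWeight ω) h r (y, s)) →
        ContinuousOn u (closure (weightedCylinder (dualWeight ω) h r (y, s))) →
        (∀ᵐ X ∂(volume : Measure (SpaceTime n)), X ∈ weightedCylinder (dualWeight ω) h r (y, s) →
          parabolicOp ω a u X ≤ 0) →
      ∀ (z : Space n) (τ : ℝ),
        ball z ρ ⊆ ball y r →
        s - h * r ^ 2 * timeScale (dualWeight ω) r y ≤ τ →
        τ ≤ s - h * (r ^ 2 / 2 + ρ ^ 2) * timeScale (dualWeight ω) r y →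
        (∀ x ∈ ball z ρ, u (x, τ) ≤ 0) →
        supPos u (weightedCylinder (dualWeight ω) h (r / 2) (y, s)) ≤
          ENNReal.ofReal β₂ * supPos u (weightedCylinder (dualWeight ω) h r (y, s)) := by
  obtain ⟨B, hB⟩ : ∃ B, B = 16 * q + 4 * q ^ 2 * K₀ * (8 * ν + 4 * n / ν) := ⟨_, rfl⟩
  obtain ⟨lam, hlam⟩ : ∃ lam, lam = B ^ 2 / (32 * ν * (4 * h)) := ⟨_, rfl⟩
  obtain ⟨G, hG⟩ : ∃ G, G = max 1 (4 * 8 ^ n * n.factorial / ν ^ n *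
    (12 * n ^ 2 / ν * (4 * q ^ 2)) ^ (n + 1) * K₀) := ⟨_, rfl⟩
  have hlam0 : 0 ≤ lam := by rw [hlam]; positivity
  have hG1 : 1 ≤ G := hG ▸ le_max_left _ _
  have hβ0 : 0 < Real.exp (-lam) := Real.exp_pos _
  have hβ1 : Real.exp (-lam) ≤ 1 := Real.exp_le_one_iff.2 (by linarith)
  have hGε : G * (Real.exp (-lam) / (2 * G)) = Real.exp (-lam) / 2 := by field_simp
  -- This `ε₂` makes the error `G ε₂ M` half of the gain `M exp(-lam)`.
  refine ⟨Real.exp (-lam) / (2 * G), 1 - Real.exp (-lam) / 2, ⟨by positivity, ?_⟩,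
    ⟨by linarith, by linarith⟩, ?_⟩
  · rw [div_lt_one (by positivity)]; linarith
  intro r ρ hρ hρr hq y s ω a hω hA hbmo ha u hu huc hLu z τ hz hτ₀ hτ₁ huτ
  set S := supPos u (weightedCylinder (dualWeight ω) h r (y, s)) with hS
  -- An infinite supremum makes the right side infinite because `β₂ > 0`; otherwise `S.toReal`
  -- serves as `M`.
  rcases eq_or_ne S ∞ with htop | hfin
  · rw [htop, ENNReal.mul_top (by simpa using by linarith)]
    exact le_top
  have huM : ∀ X ∈ weightedCylinder (dualWeight ω) h r (y, s), u X ≤ S.toReal := by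
    intro X hX
    have h1 : ENNReal.ofReal (u X) ≤ S := by
      rw [hS, supPos]
      exact le_iSup₂ (f := fun X _ => ENNReal.ofReal (u X)) X hX
    exact (ENNReal.ofReal_le_iff_le_toReal hfin).1 h1
  refine iSup₂_le fun X hX => ?_
  have h1 := growth_at_point hn hν₀ hK₀ hh₀ hh₁ hlam0
    (by rw [← hB, hlam, div_mul_cancel₀ _ (by positivity)]) hG1 (hG ▸ le_max_right _ _)
    (by positivity) hρ hρr hq hω hA hbmo ha hu huc hLu hz hτ₀ hτ₁ huτ ENNReal.toReal_nonneg huM hX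
  rw [hGε] at h1
  rw [← ENNReal.ofReal_toReal hfin, ← ENNReal.ofReal_mul (by linarith)]
  refine ENNReal.ofReal_le_ofReal (h1.trans (le_of_eq ?_))
  ring
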